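/- Let $a\in\mathbb{C}\setminus\{0,1\}$ and let $\alpha,\beta,\gamma,\delta,\varepsilon,B\in\mathbb{C}$ satisfy $\gamma+\delta+\varepsilon=1+\alpha+\beta$. Consider the Heun equation $$\frac{d^2y}{dx^2}+\left(\frac{\gamma}{x}+\frac{\delta}{x-1}+\frac{\varepsilon}{x-a}\right)\frac{dy}{dx}+\frac{\alpha\beta x-\frac{B}{4}}{x(x-1)(x-a)}\,y=0$$ on $\mathbb{C}\setminus\{0,1,a\}$. Fix a base point $p\in\mathbb{C}\setminus\{0,1,a\}$ and two linearly independent holomorphic solutions $y_1,y_2$ near $p$. Analytic continuation along a loop $\Gamma$ in $\mathbb{C}\setminus\{0,1,a\}$ based at $p$ transforms the column $(y_1,y_2)^{T}$ into $M_\Gamma\,(y_1,y_2)^{T}$ for some $M_\Gamma\in\mathrm{GL}(2,\mathbb{C})$; let $G\subset\mathrm{GL}(2,\mathbb{C})$ be the monodromy group, that is, the group generated by all the matrices $M_\Gamma$. Suppose that $G$ is unitary, that is, there is a non-degenerate (not necessarily definite) Hermitian matrix $H\in\mathbb{C}^{2\times 2}$ with $g^\dagger H g=H$ for all $g\in G$.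 Then $\gamma,\delta,\varepsilon\in\mathbb{R}$, and either $\alpha,\beta\in\mathbb{R}$ or $\alpha-\overline{\beta}\in\mathbb{Z}$ (possibly both). -/

import Mathlib

open Filter Topology

namespace Heun

/-- `f` represents a holomorphic solution, near the point `p`, of the second-order linear equation
`y'' + P y' + Q y = 0`. Only the germ of `f` at `p` matters. -/
def IsLocalSolution (P Q : ℂ → ℂ) (p : ℂ) (f : ℂ → ℂ) : Prop :=
  AnalyticAt ℂ f p ∧
    ∀ᶠ z in 𝓝 p, deriv (deriv f) z + P z * deriv f z + Q z * f z = 0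

/-- `y 0, y 1` are two solutions of `y'' + P y' + Q y = 0` near `p` whose germs at `p` are linearly
independent over `ℂ`. -/
def IsFundamentalSystem (P Q : ℂ → ℂ) (p : ℂ) (y : Fin 2 → ℂ → ℂ) : Prop :=
  (∀ i, IsLocalSolution P Q p (y i)) ∧
    ∀ c : Fin 2 → ℂ, (∀ᶠ z in 𝓝 p, c 0 * y 0 z + c 1 * y 1 z = 0) → c = 0

/-- The germ of `g` at `q` is obtained from the germ of `f` at `p` by analytic continuation along
the path `Γ`: there is a family `F t` of functions, each analytic at `Γ t`, such that for `s` close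
to `t` the functions `F s` and `F t` have the same germ at `Γ s`, which starts at the germ of `f`
and ends at the germ of `g`. -/
def IsContinuationAlong {p q : ℂ} (Γ : Path p q) (f g : ℂ → ℂ) : Prop :=
  ∃ F : unitInterval → ℂ → ℂ,
    (∀ t, AnalyticAt ℂ (F t) (Γ t)) ∧
    (∀ t, ∀ᶠ s in 𝓝 t, F s =ᶠ[𝓝 (Γ s)] F t) ∧
    F 0 =ᶠ[𝓝 p] f ∧ F 1 =ᶠ[𝓝 q] g

/-- `M` is the monodromy matrix of the pair `y` along the loop `Γ` based at `p`: analytic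
continuation along `Γ` turns the column `(y 0, y 1)` into the column `M (y 0, y 1)`. -/
def IsMonodromyMatrix {p : ℂ} (Γ : Path p p) (y : Fin 2 → ℂ → ℂ)
    (M : GL (Fin 2) ℂ) : Prop :=
  ∀ i, IsContinuationAlong Γ (y i) (fun z => M i 0 * y 0 z + M i 1 * y 1 z)

/-- The monodromy group on the punctured plane `ℂ \ S`, with respect to the base point `p` and the
fundamental system `y` at `p`: the subgroup of `GL(2, ℂ)` generated by the monodromy matrices along
all loops in `ℂ \ S` based at `p`. -/
def monodromyGroup (S : Set ℂ) (p : ℂ) (y : Fin 2 → ℂ → ℂ) : Subgroup (GL (Fin 2) ℂ) :=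
  Subgroup.closure {M | ∃ Γ : Path p p, (∀ t, Γ t ∉ S) ∧ IsMonodromyMatrix Γ y M}

/-- A matrix group is unitary if it preserves a non-degenerate, not necessarily definite, Hermitian
form. -/
def IsUnitary (G : Subgroup (GL (Fin 2) ℂ)) : Prop :=
  ∃ H : Matrix (Fin 2) (Fin 2) ℂ, H.IsHermitian ∧ H.det ≠ 0 ∧
    ∀ g ∈ G, (g : Matrix (Fin 2) (Fin 2) ℂ).conjTranspose * H * (g : Matrix (Fin 2) (Fin 2) ℂ) = H

/-- The coefficient of `dy/dx` in the Heun equation. -/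
noncomputable def coeffP (a γ δ ε : ℂ) (x : ℂ) : ℂ :=
  γ / x + δ / (x - 1) + ε / (x - a)

/-- The coefficient of `y` in the Heun equation. -/
noncomputable def coeffQ (a α β B : ℂ) (x : ℂ) : ℂ :=
  (α * β * x - B / 4) / (x * (x - 1) * (x - a))

end Heun

/-! An invariant non-degenerate form imposes two constraints on a monodromy matrix `N`: taking
determinants in `N† H N = H` gives `|det N| = 1`, and the spectrum is stable under `λ ↦ 1 / conj λ`.

The Wronskian satisfies `W' = -P W`, so continuation along a circle multiplies it by `exp(-2πi e)`,
where `e` is the sum of the exponents `γ, δ, ε` at the singular points inside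
(`exists_circle_monodromy`). A small circle around one singular point isolates one of them, and
`|det N| = 1` makes it real.

For `α, β`, take a circle enclosing all singular points, with `det N = exp(-2πi(α + β))`. If `Re β ≤
Re α`, the Frobenius method at infinity gives a solution `z^(-α) u(1/z)` without logarithms
(`exists_frobenius_at_infinity`), hence the eigenvalue `λ = exp(-2πiα)`. By `eigenvalue_of_unitary`,
either `|λ| = 1`, so `α` is real, and `β` too by the Fuchs relation, or `λ = det N · conj λ`, which
says `β - conj α ∈ ℤ`. One eigenvalue suffices, so resonance at infinity needs no separate
treatment. The other ordering follows by exchanging `α` and `β`. -/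

/-! ### Power series solutions of Fuchsian systems -/

/-- Formal solution of `t Y' = A(t) Y` with geometric bounds on its coefficients. -/
theorem exists_fuchsian_coeff {R : Type*} [NormedRing R] [NormedAlgebra ℂ R] {a b : ℕ → R} {v : R}
    {C ρ K : ℝ} (hρ : 0 < ρ) (hC : 0 < C) (hK : 0 < K) (ha : ∀ n, ‖a n‖ ≤ C * ρ ^ n)
    (hbK : ∀ n, ‖b n‖ ≤ K)
    (hb : ∀ n : ℕ, (algebraMap ℂ R ((n : ℂ) + 1) - a 0) * b n = 1) (hv : a 0 * v = 0) :
    ∃ (y : ℕ → R) (σ : ℝ), y 0 = v ∧ 0 < σ ∧ (∀ n, ‖y n‖ ≤ ‖v‖ * σ ^ n) ∧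
      ∀ n : ℕ, (n : ℂ) • y n = ∑ k ∈ Finset.range (n + 1), a k * y (n - k) := by
  let step : (n : ℕ) → ((m : ℕ) → m < n → R) → R := fun n ih =>
    match n with
    | 0 => v
    | n + 1 => b n * ∑ k : Fin (n + 1), a (k + 1) * ih (n - k) (by omega)
  let y : ℕ → R := fun n => Nat.strongRecOn n step
  have y0 : y 0 = v := by
    simp only [y]; rw [Nat.strongRecOn_eq]
  have ys : ∀ n, y (n + 1) = b n * ∑ k ∈ Finset.range (n + 1), a (k + 1) * y (n - k) := by
    intro n
    rw [Finset.sum_range]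
    simp only [y]; rw [Nat.strongRecOn_eq]
  -- Chosen so that `σ - ρ = K C ρ`: the factor produced by the recursion is then exactly the one
  -- that telescopes the geometric sum to `σ ^ (n + 1) - ρ ^ (n + 1)`.
  set σ : ℝ := ρ + K * C * ρ with hσ
  have hσ0 : 0 < σ := by positivity
  have hlt : ρ < σ := by rw [hσ]; have : 0 < K * C * ρ := by positivity
                         linarith
  refine ⟨y, σ, y0, hσ0, ?_, ?_⟩
  · intro n
    induction n using Nat.strong_induction_on with
    | _ n ih =>
      rcases n with _ | n
      · simp [y0]
      · have h1 : ∀ k ∈ Finset.range (n + 1), ‖a (k + 1) * y (n - k)‖ ≤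
            C * ‖v‖ * ρ * (ρ ^ k * σ ^ (n + 1 - 1 - k)) := by
          intro k hk
          refine (norm_mul_le _ _).trans ?_
          refine (mul_le_mul (ha _) (ih (n - k) (by omega)) (norm_nonneg _) (by positivity)).trans ?_
          apply le_of_eq
          rw [Nat.add_sub_cancel]; ring
        have h2 := (norm_sum_le _ _).trans (Finset.sum_le_sum h1)
        rw [← Finset.mul_sum] at h2
        have h3 : (∑ k ∈ Finset.range (n + 1), ρ ^ k * σ ^ (n + 1 - 1 - k)) * (ρ - σ) =
          ρ ^ (n + 1) - σ ^ (n + 1) := (Commute.all ρ σ).geom_sum₂_mul (n + 1)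
        set s := ∑ k ∈ Finset.range (n + 1), ρ ^ k * σ ^ (n + 1 - 1 - k)
        have h4 : s * (K * C * ρ) ≤ σ ^ (n + 1) := by
          have : s * (K * C * ρ) = σ ^ (n + 1) - ρ ^ (n + 1) := by
            have : ρ - σ = - (K * C * ρ) := by rw [hσ]; ring
            rw [this] at h3; linarith
          have : 0 ≤ ρ ^ (n + 1) := by positivity
          linarith
        calc ‖y (n + 1)‖ ≤ ‖b n‖ * ‖∑ k ∈ Finset.range (n + 1), a (k + 1) * y (n - k)‖ := by
              rw [ys]; exact norm_mul_le _ _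
          _ ≤ K * (C * ‖v‖ * ρ * s) := mul_le_mul (hbK n) h2 (norm_nonneg _) hK.le
          _ = ‖v‖ * (s * (K * C * ρ)) := by ring
          _ ≤ _ := by gcongr
  · intro n
    rcases n with _ | n
    · simp [y0, hv]
    · rw [Finset.sum_range_succ']
      have := congrArg (· * ∑ k ∈ Finset.range (n + 1), a (k + 1) * y (n - k)) (hb n)
      simp only [mul_assoc, ← ys, one_mul] at this
      simp only [Nat.add_sub_add_right, Nat.sub_zero]
      rw [← this, sub_mul, Algebra.algebraMap_eq_smul_one, smul_mul_assoc, one_mul]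
      push_cast
      abel

theorem hasDerivAt_tsum_pow_smul {E : Type*} [NormedAddCommGroup E] [NormedSpace ℂ E]
    [CompleteSpace E] {y : ℕ → E} {D σ : ℝ} (hσ : 0 < σ) (hy : ∀ n, ‖y n‖ ≤ D * σ ^ n)
    {t : ℂ} (ht : ‖t‖ < σ⁻¹) :
    HasDerivAt (fun t : ℂ => ∑' n, t ^ n • y n) (∑' n : ℕ, ((n : ℂ) * t ^ (n - 1)) • y n) t := by
  obtain ⟨r, htr, hr⟩ := exists_between ht
  have hr0 : 0 < r := (norm_nonneg _).trans_lt htr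
  have hrσ : r * σ < 1 := by rwa [← lt_inv_mul_iff₀' hσ, mul_one]
  have hD : 0 ≤ D := by simpa using (norm_nonneg _).trans (hy 0)
  have hgeo : Summable fun n : ℕ => (n : ℝ) ^ 1 * (r * σ) ^ n := by
    apply summable_pow_mul_geometric_of_norm_lt_one
    rw [Real.norm_of_nonneg (mul_nonneg hr0.le hσ.le)]
    exact hrσ
  have hsum : Summable fun n : ℕ => D * r⁻¹ * ((n : ℝ) ^ 1 * (r * σ) ^ n) :=
    Summable.mul_left _ hgeo
  have hbound : ∀ (n : ℕ) (z : ℂ), z ∈ Metric.ball (0 : ℂ) r →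
      ‖((n : ℂ) * z ^ (n - 1)) • y n‖ ≤ D * r⁻¹ * ((n : ℝ) ^ 1 * (r * σ) ^ n) := by
    intro n z hz
    have hz' : ‖z‖ < r := by simpa using hz
    rcases n with _ | n
    · simp
    · rw [norm_smul, norm_mul, norm_pow, Complex.norm_natCast, Nat.add_sub_cancel]
      calc ((n + 1 : ℕ) : ℝ) * ‖z‖ ^ n * ‖y (n + 1)‖
          ≤ ((n + 1 : ℕ) : ℝ) * r ^ n * (D * σ ^ (n + 1)) := by gcongr; exact hy _
        _ = D * (r⁻¹ * r) * (((n + 1 : ℕ) : ℝ) ^ 1 * (r ^ n * σ ^ (n + 1))) := by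
          rw [inv_mul_cancel₀ hr0.ne']; ring
        _ = _ := by rw [mul_pow]; ring
  have hsum0 : Summable fun n : ℕ => (0 : ℂ) ^ n • y n := by
    refine summable_of_ne_finset_zero (s := {0}) ?_
    intro n hn
    rw [zero_pow (by simpa using hn), zero_smul]
  exact hasDerivAt_tsum_of_isPreconnected (t := Metric.ball (0 : ℂ) r) (y₀ := (0 : ℂ)) hsum
    Metric.isOpen_ball (convex_ball _ _).isPreconnected (g := fun n t => t ^ n • y n)
    (g' := fun n t => ((n : ℂ) * t ^ (n - 1)) • y n)
    (fun n z _ => (hasDerivAt_pow n z).smul_const _) hbound (Metric.mem_ball_self hr0) hsum0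
    (by simpa using htr)

/-- Comparing coefficients gives `(n - A 0) y_n = ∑_{k ≥ 1} a_k y_{n-k}`, solvable since no positive
integer lies in the spectrum of `A 0`. The resolvent tends to zero at infinity, so the inverses are
uniformly bounded and the formal series converges. -/
theorem exists_fuchsian_solution {R : Type*} [NormedRing R] [NormedAlgebra ℂ R] [CompleteSpace R]
    {A : ℂ → R} (hA : AnalyticAt ℂ A 0)
    (hu : ∀ n : ℕ, IsUnit (algebraMap ℂ R ((n : ℂ) + 1) - A 0)) {v : R} (hv : A 0 * v = 0) :
    ∃ Y : ℂ → R, AnalyticAt ℂ Y 0 ∧ Y 0 = v ∧ ∀ᶠ t in 𝓝 0, t • deriv Y t = A t * Y t := by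
  obtain ⟨p, hp⟩ := hA
  have hp0 : p.coeff 0 = A 0 := hp.coeff_zero _
  obtain ⟨C, ρ, hC, hρ, hCρ⟩ := p.le_mul_pow_of_radius_pos hp.radius_pos
  have hCρ' : ∀ n, ‖p.coeff n‖ ≤ C * ρ ^ n := fun n => by
    rw [← p.norm_apply_eq_norm_coef]; exact hCρ n
  have hres : Tendsto (fun n : ℕ => resolvent (A 0) ((n : ℂ) + 1)) atTop (𝓝 0) := by
    refine (spectrum.resolvent_tendsto_cobounded (𝕜 := ℂ) (A 0)).comp ?_
    rw [← tendsto_norm_atTop_iff_cobounded]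
    have : (fun n : ℕ => ‖(n : ℂ) + 1‖) = fun n : ℕ => (n : ℝ) + 1 := by
      ext n
      rw [show (n : ℂ) + 1 = ((n + 1 : ℕ) : ℂ) by push_cast; rfl, Complex.norm_natCast]
      push_cast; rfl
    rw [this]
    exact tendsto_atTop_add_const_right _ _ tendsto_natCast_atTop_atTop
  obtain ⟨K, hK⟩ := hres.norm.bddAbove_range
  have hK' : ∀ n : ℕ, ‖resolvent (A 0) ((n : ℂ) + 1)‖ ≤ max K 1 := fun n =>
    (hK ⟨n, rfl⟩).trans (le_max_left _ _)
  obtain ⟨y, σ, y0, hσ, hy, hrec⟩ := exists_fuchsian_coeff (a := p.coeff) (v := v) hρ hC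
    (lt_of_lt_of_le one_pos (le_max_right K 1)) hCρ' hK'
    (fun n => by rw [hp0]; exact Ring.mul_inverse_cancel _ (hu n)) (by rw [hp0]; exact hv)
  have hd := fun t (ht : ‖t‖ < σ⁻¹) => hasDerivAt_tsum_pow_smul hσ hy (t := t) ht
  have hball : ∀ τ : ℝ, 0 < τ → ∀ᶠ t : ℂ in 𝓝 0, ‖t‖ < τ := fun τ hτ => by
    have := Metric.ball_mem_nhds (0 : ℂ) hτ
    filter_upwards [this] with t ht
    simpa using ht
  have hσ' : 0 < σ⁻¹ := inv_pos.2 hσ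
  refine ⟨fun t => ∑' n, t ^ n • y n, ?_, ?_, ?_⟩
  · rw [Complex.analyticAt_iff_eventually_differentiableAt]
    filter_upwards [hball _ hσ'] with t ht using (hd t ht).differentiableAt
  · beta_reduce
    rw [tsum_eq_single 0]
    · simp [y0]
    · intro n hn; simp [hn]
  · have hρ' : 0 < ρ⁻¹ := inv_pos.2 hρ
    have hgeom : ∀ {c : ℕ → R} {M τ : ℝ}, 0 < τ → (∀ n, ‖c n‖ ≤ M * τ ^ n) → ∀ {t : ℂ},
        ‖t‖ < τ⁻¹ → Summable fun n => ‖t ^ n • c n‖ := by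
      intro c M τ hτ hc t ht
      have : ‖t‖ * τ < 1 := by rwa [← lt_inv_mul_iff₀' hτ, mul_one]
      refine Summable.of_nonneg_of_le (fun _ => norm_nonneg _) (fun n => ?_)
        ((summable_geometric_of_lt_one (by positivity) this).mul_left M)
      rw [norm_smul, norm_pow, mul_pow]
      calc ‖t‖ ^ n * ‖c n‖ ≤ ‖t‖ ^ n * (M * τ ^ n) := by gcongr; exact hc n
        _ = _ := by ring
    filter_upwards [hball _ hσ', hball _ hρ', hasFPowerSeriesAt_iff.1 hp] with t ht1 ht2 ht3
    rw [zero_add] at ht3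
    rw [(hd t ht1).deriv, ← ht3.tsum_eq,
      tsum_mul_tsum_eq_tsum_sum_range_of_summable_norm (hgeom hρ hCρ' ht2) (hgeom hσ hy ht1),
      ← tsum_const_smul'']
    congr 1
    ext n
    have : ∀ k ∈ Finset.range (n + 1), (t ^ k • p.coeff k) * (t ^ (n - k) • y (n - k)) =
        t ^ n • (p.coeff k * y (n - k)) := by
      intro k hk
      have hk' : k + (n - k) = n := by have := Finset.mem_range.1 hk; omega
      rw [smul_mul_smul_comm, ← pow_add, hk']
    rw [Finset.sum_congr rfl this, ← Finset.smul_sum, ← hrec, smul_smul, smul_smul]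
    rcases n with _ | n
    · simp
    · rw [Nat.add_sub_cancel]; congr 1; ring

namespace Heun

/-! ### Analytic continuation of germs along paths -/

theorem eventuallyEq_nhds_of_eventuallyEq {f g : ℂ → ℂ} {X : Type*} [TopologicalSpace X]
    {Γ : X → ℂ} {t : X} (hΓ : ContinuousAt Γ t) (h : f =ᶠ[𝓝 (Γ t)] g) :
    ∀ᶠ s in 𝓝 t, f =ᶠ[𝓝 (Γ s)] g :=
  hΓ.eventually (eventually_eventually_nhds.2 h)

namespace IsContinuationAlong

variable {p q r : ℂ} {Γ : Path p q} {f g f₁ g₁ f₂ g₂ : ℂ → ℂ}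

theorem analyticAt_right (h : IsContinuationAlong Γ f g) : AnalyticAt ℂ g q := by
  obtain ⟨F, hF, -, -, h1⟩ := h
  have := hF 1
  rw [Γ.target] at this
  exact this.congr h1

theorem congr (h : IsContinuationAlong Γ f g) (hf : f =ᶠ[𝓝 p] f₁) (hg : g =ᶠ[𝓝 q] g₁) :
    IsContinuationAlong Γ f₁ g₁ := by
  obtain ⟨F, hF, hl, h0, h1⟩ := h
  exact ⟨F, hF, hl, h0.trans hf, h1.trans hg⟩

/-- Continuation commutes with every binary operation that depends only on germs and preserves
analyticity; products, linear combinations and Wronskians are instances. -/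
theorem map₂ (φ : (ℂ → ℂ) → (ℂ → ℂ) → ℂ → ℂ)
    (hφa : ∀ {f g z}, AnalyticAt ℂ f z → AnalyticAt ℂ g z → AnalyticAt ℂ (φ f g) z)
    (hφ : ∀ {f f' g g' : ℂ → ℂ} {z}, f =ᶠ[𝓝 z] f' → g =ᶠ[𝓝 z] g' → φ f g =ᶠ[𝓝 z] φ f' g')
    (h₁ : IsContinuationAlong Γ f₁ g₁) (h₂ : IsContinuationAlong Γ f₂ g₂) :
    IsContinuationAlong Γ (φ f₁ f₂) (φ g₁ g₂) := by
  obtain ⟨F, hF, hl, h0, h1⟩ := h₁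
  obtain ⟨F', hF', hl', h0', h1'⟩ := h₂
  refine ⟨fun t => φ (F t) (F' t), fun t => hφa (hF t) (hF' t), fun t => ?_, hφ h0 h0', hφ h1 h1'⟩
  filter_upwards [hl t, hl' t] with s hs hs' using hφ hs hs'

theorem mul (h₁ : IsContinuationAlong Γ f₁ g₁) (h₂ : IsContinuationAlong Γ f₂ g₂) :
    IsContinuationAlong Γ (fun z => f₁ z * f₂ z) (fun z => g₁ z * g₂ z) :=
  map₂ (fun f g z => f z * g z) (fun hf hg => hf.mul hg) (fun hf hg => hf.mul hg) h₁ h₂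

theorem linearCombination (a b : ℂ) (h₁ : IsContinuationAlong Γ f₁ g₁)
    (h₂ : IsContinuationAlong Γ f₂ g₂) :
    IsContinuationAlong Γ (fun z => a * f₁ z + b * f₂ z) (fun z => a * g₁ z + b * g₂ z) := by
  refine map₂ (fun f g z => a * f z + b * g z)
    (fun hf hg => (analyticAt_const.mul hf).add (analyticAt_const.mul hg)) ?_ h₁ h₂
  intro f f' g g' z hf hg
  filter_upwards [hf, hg] with w h h'
  rw [h, h']

theorem wronskian (h₁ : IsContinuationAlong Γ f₁ g₁) (h₂ : IsContinuationAlong Γ f₂ g₂) :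
    IsContinuationAlong Γ (fun z => f₁ z * deriv f₂ z - deriv f₁ z * f₂ z)
      (fun z => g₁ z * deriv g₂ z - deriv g₁ z * g₂ z) := by
  refine map₂ (fun f g z => f z * deriv g z - deriv f z * g z)
    (fun hf hg => (hf.mul hg.deriv).sub (hf.deriv.mul hg)) ?_ h₁ h₂
  intro f f' g g' z hf hg
  filter_upwards [hf, hg, hf.deriv, hg.deriv] with w h h' k k'
  rw [h, h', k, k']

theorem of_analyticAt (h : ∀ t, AnalyticAt ℂ f (Γ t)) : IsContinuationAlong Γ f f :=
  ⟨fun _ => f, h, fun _ => Eventually.of_forall fun _ => EventuallyEq.rfl, EventuallyEq.rfl,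
    EventuallyEq.rfl⟩

theorem symm (h : IsContinuationAlong Γ f g) : IsContinuationAlong Γ.symm g f := by
  obtain ⟨F, hF, hl, h0, h1⟩ := h
  refine ⟨fun t => F (unitInterval.symm t), fun t => hF _, fun t => ?_, ?_, ?_⟩
  · exact (unitInterval.continuous_symm.tendsto t).eventually (hl (unitInterval.symm t))
  · simpa using h1
  · simpa using h0

/-- Uniqueness of continuation: the parameters at which the two families have equal germs form a
clopen subset of the connected unit interval, containing `0`. -/
theorem eventuallyEq (h₁ : IsContinuationAlong Γ f₁ g₁) (h₂ : IsContinuationAlong Γ f₂ g₂)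
    (h : f₁ =ᶠ[𝓝 p] f₂) : g₁ =ᶠ[𝓝 q] g₂ := by
  obtain ⟨F, hF, hl, h0, h1⟩ := h₁
  obtain ⟨F', hF', hl', h0', h1'⟩ := h₂
  let S : Set unitInterval := {t | F t =ᶠ[𝓝 (Γ t)] F' t}
  have hΓ : ∀ t, ContinuousAt Γ t := fun t => Γ.continuous.continuousAt
  have hopen : IsOpen S := by
    rw [isOpen_iff_mem_nhds]
    intro t ht
    filter_upwards [hl t, hl' t, eventuallyEq_nhds_of_eventuallyEq (hΓ t) ht] with s hs hs' hst
    exact hs.trans (hst.trans hs'.symm)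
  have hclosed : IsClosed S := by
    rw [isClosed_iff_frequently]
    intro t ht
    -- Closedness is the identity theorem on a disc around `Γ t`: agreement of germs at one nearby
    -- `Γ s` propagates to the centre.
    obtain ⟨ρ, hρ, hb⟩ := Metric.eventually_nhds_iff_ball.1
      ((hF t).eventually_analyticAt.and (hF' t).eventually_analyticAt)
    have hmem : ∀ᶠ s in 𝓝 t, Γ s ∈ Metric.ball (Γ t) ρ :=
      (hΓ t).eventually (Metric.ball_mem_nhds _ hρ)
    obtain ⟨s, hsS, hs, hs', hsb⟩ := (ht.and_eventually ((hl t).and ((hl' t).and hmem))).exists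
    have hE : F t =ᶠ[𝓝 (Γ s)] F' t := hs.symm.trans (EventuallyEq.trans hsS hs')
    have := AnalyticOnNhd.eqOn_of_preconnected_of_eventuallyEq (fun z hz => (hb z hz).1)
      (fun z hz => (hb z hz).2) (convex_ball (Γ t) ρ).isPreconnected hsb hE
    filter_upwards [Metric.ball_mem_nhds (Γ t) hρ] with z hz using this hz
  have huniv : S = Set.univ := IsClopen.eq_univ ⟨hclosed, hopen⟩ ⟨0, by
    change F 0 =ᶠ[𝓝 (Γ 0)] F' 0
    rw [Γ.source]
    exact h0.trans (h.trans h0'.symm)⟩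
  have h1S : F 1 =ᶠ[𝓝 (Γ 1)] F' 1 := by
    change (1 : unitInterval) ∈ S
    rw [huniv]; trivial
  rw [Γ.target] at h1S
  exact h1.symm.trans (h1S.trans h1')

theorem trans {Γ' : Path q r} {k : ℂ → ℂ} (h : IsContinuationAlong Γ f g)
    (h' : IsContinuationAlong Γ' g k) : IsContinuationAlong (Γ.trans Γ') f k := by
  obtain ⟨F, hF, hl, h0, h1⟩ := h
  obtain ⟨F', hF', hl', h0', h1'⟩ := h'
  -- Clamping makes both reparametrisations continuous on the whole interval, so both local
  -- compatibilities are available at the junction `t = 1 / 2`.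
  let a : unitInterval → unitInterval := fun t => Set.projIcc (0 : ℝ) 1 zero_le_one (2 * t)
  let b : unitInterval → unitInterval := fun t => Set.projIcc (0 : ℝ) 1 zero_le_one (2 * t - 1)
  have ha : Continuous a := continuous_projIcc.comp (by fun_prop)
  have hb : Continuous b := continuous_projIcc.comp (by fun_prop)
  have hb0 : ∀ t : unitInterval, (t : ℝ) ≤ 1 / 2 → b t = 0 := fun t ht =>
    Set.projIcc_of_le_left _ (by linarith)
  have ha1 : ∀ t : unitInterval, 1 / 2 ≤ (t : ℝ) → a t = 1 := fun t ht =>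
    Set.projIcc_of_right_le _ (by linarith)
  have hT1 : ∀ t : unitInterval, (t : ℝ) ≤ 1 / 2 → (Γ.trans Γ') t = Γ (a t) := by
    intro t ht
    rw [Path.trans_apply, dif_pos ht]
    congr 1
    exact (Set.projIcc_of_mem _ _).symm
  have hT2 : ∀ t : unitInterval, 1 / 2 ≤ (t : ℝ) → (Γ.trans Γ') t = Γ' (b t) := by
    intro t ht
    rcases ht.eq_or_lt with ht | ht
    · rw [hT1 t ht.symm.le, ha1 t ht.le, hb0 t ht.symm.le]; simp
    · rw [Path.trans_apply, dif_neg (by linarith)]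
      congr 1
      exact (Set.projIcc_of_mem _ _).symm
  have hgl : F 1 =ᶠ[𝓝 q] F' 0 := h1.trans h0'.symm
  refine ⟨fun t => if (t : ℝ) ≤ 1 / 2 then F (a t) else F' (b t), ?_, ?_, ?_, ?_⟩
  · intro t
    beta_reduce
    split_ifs with ht
    · rw [hT1 t ht]; exact hF _
    · rw [hT2 t (by linarith)]; exact hF' _
  · intro t
    have hA := (ha.tendsto t).eventually (hl (a t))
    have hB := (hb.tendsto t).eventually (hl' (b t))
    have hcoe : Continuous fun t : unitInterval => (t : ℝ) := continuous_subtype_val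
    rcases lt_trichotomy (t : ℝ) (1 / 2) with ht | ht | ht
    · filter_upwards [hA, hcoe.continuousAt.eventually (gt_mem_nhds ht)] with s hs hst
      rw [if_pos hst.le, if_pos ht.le, hT1 s hst.le]
      exact hs
    · have hgl' : ∀ᶠ s in 𝓝 t, F 1 =ᶠ[𝓝 (Γ.trans Γ' s)] F' 0 := by
        refine eventuallyEq_nhds_of_eventuallyEq (Γ.trans Γ').continuous.continuousAt ?_
        rw [hT1 t ht.le, ha1 t ht.ge, Γ.target]
        exact hgl
      filter_upwards [hA, hB, hgl'] with s hs hs' hs''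
      rw [if_pos ht.le]
      split_ifs with hst
      · rw [hT1 s hst]; exact hs
      · have hst' : (1 : ℝ) / 2 ≤ s := by linarith
        rw [ha1 t ht.ge]
        rw [hb0 t ht.le] at hs'
        refine EventuallyEq.trans ?_ hs''.symm
        rw [hT2 s hst']
        exact hs'
    · filter_upwards [hB, hcoe.continuousAt.eventually (lt_mem_nhds ht)] with s hs hst
      rw [if_neg (not_le.2 hst), if_neg (not_le.2 ht), hT2 s (le_of_lt hst)]
      exact hs
  · have : a 0 = 0 := by
      refine Set.projIcc_of_le_left _ ?_
      simp
    beta_reduce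
    rw [if_pos (by simp), this]
    exact h0
  · have : b 1 = 1 := by
      refine Set.projIcc_of_right_le _ ?_
      simp; norm_num
    beta_reduce
    rw [if_neg (by simp; norm_num), this]
    exact h1'

end IsContinuationAlong

/-! ### Branches of complex powers -/

/-- A branch of `(z - s) ^ e` and its continuation along a path with a continuous logarithm. -/
theorem exists_powerBranch {p q : ℂ} (Γ : Path p q) {s : ℂ} (e : ℂ) {L : unitInterval → ℂ}
    (hL : Continuous L) (hexp : ∀ t, Complex.exp (L t) = Γ t - s) :
    ∃ f g : ℂ → ℂ, IsContinuationAlong Γ f g ∧ f p ≠ 0 ∧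
      (∀ᶠ z in 𝓝 p, HasDerivAt f (e / (z - s) * f z) z) ∧
      (q = p → g =ᶠ[𝓝 p] fun z => Complex.exp (e * (L 1 - L 0)) * f z) := by
  -- Near `Γ t` the quotient is close to `1`, so the principal logarithm is analytic there; `L t`
  -- carries the winding.
  let F : unitInterval → ℂ → ℂ := fun t z =>
    Complex.exp (e * (L t + Complex.log ((z - s) / (Γ t - s))))
  have hne : ∀ t, Γ t - s ≠ 0 := fun t => hexp t ▸ Complex.exp_ne_zero _
  have hslit : ∀ t, (Γ t - s) / (Γ t - s) ∈ Complex.slitPlane := fun t => by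
    rw [div_self (hne t)]; exact Complex.one_mem_slitPlane
  have hderiv : ∀ t, ∀ᶠ z in 𝓝 (Γ t), HasDerivAt (F t) (e / (z - s) * F t z) z := by
    intro t
    have hc : ContinuousAt (fun z => (z - s) / (Γ t - s)) (Γ t) := by fun_prop
    filter_upwards [hc.eventually (Complex.isOpen_slitPlane.mem_nhds (hslit t))] with z hz
    have hz0 : z - s ≠ 0 := by
      intro h; rw [h, zero_div] at hz
      exact Complex.zero_notMem_slitPlane hz
    have h1 : HasDerivAt (fun z => (z - s) / (Γ t - s)) (1 / (Γ t - s)) z :=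
      ((hasDerivAt_id z).sub_const s).div_const _
    have h2 := (((h1.clog hz).const_add (L t)).const_mul e).cexp
    convert! h2 using 1
    have := hne t
    simp only [F]
    field_simp
  have hlocal : ∀ t, ∀ᶠ u in 𝓝 t, ∀ᶠ z in 𝓝 (Γ u),
      L u + Complex.log ((z - s) / (Γ u - s)) = L t + Complex.log ((z - s) / (Γ t - s)) := by
    intro t
    let Φ : unitInterval × ℂ → ℂ := fun x => L x.1 + Complex.log ((x.2 - s) / (Γ x.1 - s)) -
      (L t + Complex.log ((x.2 - s) / (Γ t - s)))
    have hΦc : ContinuousAt Φ (t, Γ t) := by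
      have c1 : ContinuousAt (fun x : unitInterval × ℂ => (x.2 - s) / (Γ x.1 - s)) (t, Γ t) := by
        refine ContinuousAt.div ?_ ?_ (hne t)
        · fun_prop
        · exact ((Γ.continuous.comp continuous_fst).sub continuous_const).continuousAt
      have c2 : ContinuousAt (fun x : unitInterval × ℂ => (x.2 - s) / (Γ t - s)) (t, Γ t) := by
        fun_prop
      exact (((hL.comp continuous_fst).continuousAt.add (c1.clog (hslit t)))).sub
        (continuousAt_const.add (c2.clog (hslit t)))
    have hΦ0 : Φ (t, Γ t) = 0 := by simp [Φ]
    have hev : ∀ᶠ x in 𝓝 (t, Γ t), ‖Φ x‖ < 1 ∧ x.2 - s ≠ 0 := by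
      refine Eventually.and ?_ ?_
      · refine hΦc.norm.eventually (gt_mem_nhds ?_)
        beta_reduce
        rw [hΦ0]; simp
      · have : ContinuousAt (fun x : unitInterval × ℂ => x.2 - s) (t, Γ t) := by fun_prop
        exact this.eventually_ne (hne t)
    -- Two logarithms of `z - s` differ by a multiple of `2πi`, which vanishes once its norm is
    -- below `1`.
    have hzero : ∀ᶠ x in 𝓝 (t, Γ t), Φ x = 0 := by
      filter_upwards [hev] with x hx
      have hexp1 : Complex.exp (Φ x) = 1 := by
        simp only [Φ]
        rw [Complex.exp_sub, Complex.exp_add, Complex.exp_add, hexp, hexp,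
          Complex.exp_log (div_ne_zero hx.2 (hne _)), Complex.exp_log (div_ne_zero hx.2 (hne _)),
          mul_div_cancel₀ _ (hne _), mul_div_cancel₀ _ (hne _), div_self hx.2]
      obtain ⟨n, hn⟩ := Complex.exp_eq_one_iff.1 hexp1
      have hn1 := hx.1
      rw [hn] at hn1 ⊢
      have : n = 0 := by
        by_contra h
        have h1 : (1 : ℝ) ≤ |(n : ℝ)| := by exact_mod_cast Int.one_le_abs h
        simp only [norm_mul, Complex.norm_intCast, Complex.norm_I, Complex.norm_ofNat,
          Complex.norm_real, mul_one, Real.norm_of_nonneg Real.pi_pos.le] at hn1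
        nlinarith [Real.pi_gt_three]
      simp [this]
    have hgraph : ContinuousAt (fun u => (u, Γ u)) t :=
      continuousAt_id.prodMk Γ.continuous.continuousAt
    filter_upwards [hgraph.eventually (eventually_eventually_nhds.2 hzero)] with u hu
    have : ContinuousAt (fun z : ℂ => (u, z)) (Γ u) := by fun_prop
    filter_upwards [this.eventually hu] with z hz
    exact sub_eq_zero.1 hz
  refine ⟨F 0, F 1, ⟨F, ?_, ?_, EventuallyEq.rfl, EventuallyEq.rfl⟩, Complex.exp_ne_zero _, ?_, ?_⟩
  · intro t
    rw [Complex.analyticAt_iff_eventually_differentiableAt]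
    filter_upwards [hderiv t] with z hz using hz.differentiableAt
  · intro t
    filter_upwards [hlocal t] with u hu
    filter_upwards [hu] with z hz
    simp only [F, hz]
  · simpa using hderiv 0
  · intro hqp
    refine Eventually.of_forall fun z => ?_
    simp only [F]
    rw [← Complex.exp_add, Γ.source, Γ.target, hqp]
    congr 1; ring

/-! ### Local solutions and Wronskians -/

/-- The Wronskian of two functions. -/
noncomputable def wronskian (f g : ℂ → ℂ) (z : ℂ) : ℂ := f z * deriv g z - deriv f z * g z

theorem eventually_eq_of_hasDerivAt_zero {φ : ℂ → ℂ} {p : ℂ}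
    (h : ∀ᶠ z in 𝓝 p, HasDerivAt φ 0 z) : ∀ᶠ z in 𝓝 p, φ z = φ p := by
  obtain ⟨ρ, hρ, hb⟩ := Metric.eventually_nhds_iff_ball.1 h
  filter_upwards [Metric.ball_mem_nhds p hρ] with z hz
  exact Metric.isOpen_ball.is_const_of_deriv_eq_zero (convex_ball p ρ).isPreconnected
    (fun w hw => (hb w hw).differentiableAt.differentiableWithinAt) (fun w hw => (hb w hw).deriv)
    hz (Metric.mem_ball_self hρ)

variable {P Q : ℂ → ℂ} {p : ℂ} {f g f₀ f₁ : ℂ → ℂ}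

theorem IsLocalSolution.eventually (h : IsLocalSolution P Q p f) :
    ∀ᶠ z in 𝓝 p, IsLocalSolution P Q z f :=
  h.1.eventually_analyticAt.and (eventually_eventually_nhds.2 h.2)

theorem IsLocalSolution.linearCombination (hf : IsLocalSolution P Q p f)
    (hg : IsLocalSolution P Q p g) (a b : ℂ) :
    IsLocalSolution P Q p (fun z => a * f z + b * g z) := by
  refine ⟨(analyticAt_const.mul hf.1).add (analyticAt_const.mul hg.1), ?_⟩
  have hd : deriv (fun z => a * f z + b * g z) =ᶠ[𝓝 p] fun z => a * deriv f z + b * deriv g z := by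
    filter_upwards [hf.1.eventually_analyticAt, hg.1.eventually_analyticAt] with z h1 h2
    exact ((h1.differentiableAt.hasDerivAt.const_mul a).add
      (h2.differentiableAt.hasDerivAt.const_mul b)).deriv
  have hd2 : deriv (fun z => a * deriv f z + b * deriv g z) =ᶠ[𝓝 p]
      fun z => a * deriv (deriv f) z + b * deriv (deriv g) z := by
    filter_upwards [hf.1.eventually_analyticAt, hg.1.eventually_analyticAt] with z h1 h2
    exact ((h1.deriv.differentiableAt.hasDerivAt.const_mul a).add
      (h2.deriv.differentiableAt.hasDerivAt.const_mul b)).deriv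
  filter_upwards [hd, hd.deriv, hd2, hf.2, hg.2] with z e1 e2 e3 s1 s2
  rw [e2, e3, e1]
  linear_combination a * s1 + b * s2

theorem IsLocalSolution.hasDerivAt_wronskian (hf : IsLocalSolution P Q p f)
    (hg : IsLocalSolution P Q p g) :
    ∀ᶠ z in 𝓝 p, HasDerivAt (wronskian f g) (-P z * wronskian f g z) z := by
  filter_upwards [hf.1.eventually_analyticAt, hg.1.eventually_analyticAt, hf.2, hg.2]
    with z h1 h2 s1 s2
  have := (h1.differentiableAt.hasDerivAt.mul h2.deriv.differentiableAt.hasDerivAt).sub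
    (h1.deriv.differentiableAt.hasDerivAt.mul h2.differentiableAt.hasDerivAt)
  convert! this using 1
  simp only [wronskian]
  linear_combination g z * s1 - f z * s2

theorem eventually_eq_const_mul {φ ψ : ℂ → ℂ} {R : ℂ → ℂ}
    (hφ : ∀ᶠ z in 𝓝 p, HasDerivAt φ (R z * φ z) z) (hψ : ∀ᶠ z in 𝓝 p, HasDerivAt ψ (R z * ψ z) z)
    (hψ0 : ψ p ≠ 0) : ∃ c : ℂ, ∀ᶠ z in 𝓝 p, φ z = c * ψ z := by
  have hne : ∀ᶠ z in 𝓝 p, ψ z ≠ 0 := hψ.self_of_nhds.continuousAt.eventually_ne hψ0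
  have hq : ∀ᶠ z in 𝓝 p, HasDerivAt (fun z => φ z / ψ z) 0 z := by
    filter_upwards [hφ, hψ, hne] with z h1 h2 h3
    convert! h1.div h2 h3 using 1
    rw [eq_div_iff (pow_ne_zero 2 h3)]
    ring
  refine ⟨φ p / ψ p, ?_⟩
  filter_upwards [eventually_eq_of_hasDerivAt_zero hq, hne] with z h1 h2
  rw [← h1, div_mul_cancel₀ _ h2]

/-- Cramer's rule: the coefficients are quotients of Wronskians. All Wronskians satisfy `W' = -P W`,
so these quotients are constant, and no uniqueness theorem for the second-order equation is needed.
-/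
theorem IsLocalSolution.exists_eq_combination (h₀ : IsLocalSolution P Q p f₀)
    (h₁ : IsLocalSolution P Q p f₁) (hW : wronskian f₀ f₁ p ≠ 0) (hg : IsLocalSolution P Q p g) :
    ∃ a b : ℂ, g =ᶠ[𝓝 p] fun z => a * f₀ z + b * f₁ z := by
  have hD := h₀.hasDerivAt_wronskian h₁
  obtain ⟨a, ha⟩ := eventually_eq_const_mul (hg.hasDerivAt_wronskian h₁) hD hW
  obtain ⟨b, hb⟩ := eventually_eq_const_mul (h₀.hasDerivAt_wronskian hg) hD hW
  refine ⟨a, b, ?_⟩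
  filter_upwards [ha, hb, hD.self_of_nhds.continuousAt.eventually_ne hW] with z h1 h2 h3
  apply mul_right_cancel₀ h3
  simp only [wronskian] at *
  linear_combination f₀ z * h1 + f₁ z * h2

/-! ### Local existence of solutions -/

open scoped Matrix.Norms.Operator in
/-- The Fuchsian existence theorem for two-by-two systems, in coordinates. -/
theorem exists_fuchsian_matrix_solution {A : ℂ → Matrix (Fin 2) (Fin 2) ℂ}
    (hA : ∀ i j, AnalyticAt ℂ (fun t => A t i j) 0)
    (hu : ∀ n : ℕ, IsUnit (algebraMap ℂ (Matrix (Fin 2) (Fin 2) ℂ) ((n : ℂ) + 1) - A 0))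
    {v : Matrix (Fin 2) (Fin 2) ℂ} (hv : A 0 * v = 0) :
    ∃ y : Fin 2 → Fin 2 → ℂ → ℂ, (∀ i j, AnalyticAt ℂ (y i j) 0) ∧ (∀ i j, y i j 0 = v i j) ∧
      ∀ i j, ∀ᶠ t in 𝓝 0, t * deriv (y i j) t = A t i 0 * y 0 j t + A t i 1 * y 1 j t := by
  have hA' : AnalyticAt ℂ A 0 := by
    have : A = fun t => A t 0 0 • !![1, 0; 0, 0] + A t 0 1 • !![0, 1; 0, 0] +
        A t 1 0 • !![0, 0; 1, 0] + A t 1 1 • (!![0, 0; 0, 1] : Matrix (Fin 2) (Fin 2) ℂ) := by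
      ext t i j
      fin_cases i <;> fin_cases j <;> simp
    rw [this]
    exact ((((hA 0 0).smul analyticAt_const).add ((hA 0 1).smul analyticAt_const)).add
      ((hA 1 0).smul analyticAt_const)).add ((hA 1 1).smul analyticAt_const)
  obtain ⟨Y, hY, hY0, hYd⟩ := exists_fuchsian_solution hA' hu hv
  let E : Fin 2 → Fin 2 → Matrix (Fin 2) (Fin 2) ℂ →L[ℂ] ℂ := fun i j =>
    (Matrix.entryLinearMap ℂ ℂ i j).toContinuousLinearMap
  refine ⟨fun i j t => E i j (Y t), fun i j => ((E i j).analyticAt _).fun_comp hY,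
    fun i j => by simp [E, hY0], fun i j => ?_⟩
  filter_upwards [hYd, hY.eventually_analyticAt] with t ht hta
  have h1 : deriv (fun t => E i j (Y t)) t = E i j (deriv Y t) :=
    ((E i j).hasFDerivAt.comp_hasDerivAt t hta.differentiableAt.hasDerivAt).deriv
  have h2 := congrArg (E i j) ht
  rw [map_smul, smul_eq_mul] at h2
  refine (congrArg (t * ·) h1).trans (h2.trans ?_)
  simp [E, Matrix.mul_apply, Fin.sum_univ_two]

/-- An ordinary point is a Fuchsian point with `A(t) = t C(t)`, where `C` is the companion matrix.
Since `A 0 = 0`, the initial value may be the identity. -/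
theorem exists_basis (hP : AnalyticAt ℂ P p) (hQ : AnalyticAt ℂ Q p) :
    ∃ f₀ f₁ : ℂ → ℂ, IsLocalSolution P Q p f₀ ∧ IsLocalSolution P Q p f₁ ∧
      wronskian f₀ f₁ p ≠ 0 := by
  let C : ℂ → Matrix (Fin 2) (Fin 2) ℂ := fun t => !![0, 1; -Q (p + t), -P (p + t)]
  have hsh : AnalyticAt ℂ (fun t => p + t) 0 := analyticAt_const.add analyticAt_id
  have hP' : AnalyticAt ℂ (fun t => P (p + t)) 0 := by
    refine AnalyticAt.fun_comp ?_ hsh; simpa using hP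
  have hQ' : AnalyticAt ℂ (fun t => Q (p + t)) 0 := by
    refine AnalyticAt.fun_comp ?_ hsh; simpa using hQ
  have hC : ∀ i j, AnalyticAt ℂ (fun t => C t i j) 0 := by
    intro i j
    fin_cases i <;> fin_cases j
    exacts [analyticAt_const, analyticAt_const, hQ'.neg, hP'.neg]
  obtain ⟨y, hy, hy0, hyd⟩ := exists_fuchsian_matrix_solution (A := fun t => t • C t) (v := 1)
    (fun i j => analyticAt_id.mul (hC i j)) (fun n => by
      simp only [zero_smul, sub_zero]
      exact (IsUnit.mk0 _ (Nat.cast_add_one_ne_zero n)).map _) (by simp)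
  have hd : ∀ i j, ∀ᶠ t in 𝓝 0, deriv (y i j) t = C t i 0 * y 0 j t + C t i 1 * y 1 j t := by
    intro i j
    -- The factor `t` cancels only off `0`; analyticity of both sides restores the equation at `0`.
    have h1 : ∃ᶠ t in 𝓝[≠] (0 : ℂ), deriv (y i j) t = C t i 0 * y 0 j t + C t i 1 * y 1 j t := by
      refine Eventually.frequently ?_
      filter_upwards [(hyd i j).filter_mono nhdsWithin_le_nhds, self_mem_nhdsWithin] with t ht ht0
      refine mul_left_cancel₀ ht0 (ht.trans ?_)
      simp only [Matrix.smul_apply, smul_eq_mul]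
      ring
    exact ((hy i j).deriv.frequently_eq_iff_eventually_eq
      (((hC i 0).mul (hy 0 j)).add ((hC i 1).mul (hy 1 j)))).1 h1
  have ht : Tendsto (fun z => z - p) (𝓝 p) (𝓝 0) := by
    have : ContinuousAt (fun z => z - p) p := by fun_prop
    simpa [ContinuousAt] using this
  let u : Fin 2 → Fin 2 → ℂ → ℂ := fun i j z => y i j (z - p)
  have hud : ∀ i j, ∀ᶠ z in 𝓝 p,
      HasDerivAt (u i j) (C (z - p) i 0 * u 0 j z + C (z - p) i 1 * u 1 j z) z := by
    intro i j
    filter_upwards [ht.eventually ((hd i j).and (hy i j).eventually_analyticAt)] with z hz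
    have h1 := hz.2.differentiableAt.hasDerivAt
    rw [hz.1] at h1
    exact HasDerivAt.comp_sub_const z p h1
  have h0 : ∀ j, ∀ᶠ z in 𝓝 p, HasDerivAt (u 0 j) (u 1 j z) z := fun j => by
    filter_upwards [hud 0 j] with z hz
    simpa [C] using hz
  have h1 : ∀ j, ∀ᶠ z in 𝓝 p, HasDerivAt (u 1 j) (-Q z * u 0 j z - P z * u 1 j z) z := fun j => by
    filter_upwards [hud 1 j] with z hz
    simpa [C, sub_eq_add_neg] using hz
  have hsol : ∀ j, IsLocalSolution P Q p (u 0 j) := fun j => by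
    refine ⟨AnalyticAt.fun_comp (by simpa using hy 0 j) (analyticAt_id.sub analyticAt_const), ?_⟩
    have hd1 : deriv (u 0 j) =ᶠ[𝓝 p] u 1 j := by
      filter_upwards [h0 j] with z hz using hz.deriv
    filter_upwards [hd1, hd1.deriv, h1 j] with z e1 e2 e3
    rw [e2, e1, e3.deriv]; ring
  refine ⟨u 0 0, u 0 1, hsol 0, hsol 1, ?_⟩
  rw [wronskian, (h0 0).self_of_nhds.deriv, (h0 1).self_of_nhds.deriv]
  simp [u, hy0]

/-- Near an ordinary point all local solutions extend to a common neighbourhood. -/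
theorem exists_extension_nhds (hP : AnalyticAt ℂ P p) (hQ : AnalyticAt ℂ Q p) :
    ∃ U : Set ℂ, IsOpen U ∧ p ∈ U ∧ ∀ q ∈ U, ∀ g, IsLocalSolution P Q q g →
      ∃ h, (∀ z ∈ U, IsLocalSolution P Q z h) ∧ h =ᶠ[𝓝 q] g := by
  obtain ⟨f₀, f₁, h₀, h₁, hW⟩ := exists_basis hP hQ
  have hWc := (h₀.hasDerivAt_wronskian h₁).self_of_nhds.continuousAt
  obtain ⟨ρ, hρ, hb⟩ := Metric.eventually_nhds_iff_ball.1
    (h₀.eventually.and (h₁.eventually.and (hWc.eventually_ne hW)))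
  refine ⟨Metric.ball p ρ, Metric.isOpen_ball, Metric.mem_ball_self hρ, fun q hq g hg => ?_⟩
  obtain ⟨a, b, hab⟩ := (hb q hq).1.exists_eq_combination (hb q hq).2.1 (hb q hq).2.2 hg
  exact ⟨_, fun z hz => (hb z hz).1.linearCombination (hb z hz).2.1 a b, hab.symm⟩

/-- In a basis with non-zero Wronskian, the Wronskian of the pair is multiplied by the determinant
of its coefficients. If that vanished, the columns of the adjugate would give linear relations,
which independence forbids. -/
theorem IsFundamentalSystem.wronskian_ne_zero (hP : AnalyticAt ℂ P p) (hQ : AnalyticAt ℂ Q p)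
    {y : Fin 2 → ℂ → ℂ} (hy : IsFundamentalSystem P Q p y) : wronskian (y 0) (y 1) p ≠ 0 := by
  obtain ⟨f₀, f₁, h₀, h₁, hW⟩ := exists_basis hP hQ
  obtain ⟨a, b, hab⟩ := h₀.exists_eq_combination h₁ hW (hy.1 0)
  obtain ⟨c, d, hcd⟩ := h₀.exists_eq_combination h₁ hW (hy.1 1)
  have hd : ∀ a b : ℂ, deriv (fun z => a * f₀ z + b * f₁ z) p = a * deriv f₀ p + b * deriv f₁ p :=
    fun a b => ((h₀.1.differentiableAt.hasDerivAt.const_mul a).add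
      (h₁.1.differentiableAt.hasDerivAt.const_mul b)).deriv
  have hdet : wronskian (y 0) (y 1) p = (a * d - b * c) * wronskian f₀ f₁ p := by
    rw [wronskian, wronskian, hab.eq_of_nhds, hcd.eq_of_nhds, hab.deriv_eq, hcd.deriv_eq, hd, hd]
    ring
  rw [hdet]
  refine mul_ne_zero (fun h0 => ?_) hW
  have e1 := hy.2 ![d, -b] (by
    filter_upwards [hab, hcd] with z u v
    simp only [Matrix.cons_val_zero, Matrix.cons_val_one, u, v]
    linear_combination f₀ z * h0)
  have e2 := hy.2 ![-c, a] (by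
    filter_upwards [hab, hcd] with z u v
    simp only [Matrix.cons_val_zero, Matrix.cons_val_one, u, v]
    linear_combination f₁ z * h0)
  have hb : b = 0 := by simpa using congrFun e1 1
  have ha : a = 0 := by simpa using congrFun e2 1
  have e3 := hy.2 ![1, 0] (by
    filter_upwards [hab] with z u
    simp [u, ha, hb])
  simpa using congrFun e3 0

/-! ### Continuation of solutions and monodromy matrices -/

theorem IsLocalSolution.exists_continuation {S : Set ℂ}
    (hPQ : ∀ z ∉ S, AnalyticAt ℂ P z ∧ AnalyticAt ℂ Q z) {p q : ℂ} (Γ : Path p q)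
    (hΓ : ∀ t, Γ t ∉ S) (hf : IsLocalSolution P Q p f) :
    ∃ g, IsContinuationAlong Γ f g ∧ IsLocalSolution P Q q g := by
  choose U hUo hUp hU using fun t : unitInterval =>
    exists_extension_nhds (hPQ _ (hΓ t)).1 (hPQ _ (hΓ t)).2
  obtain ⟨τ, hτ0, hτm, ⟨N, hN⟩, hτ⟩ := exists_monotone_Icc_subset_open_cover_unitInterval
    (c := fun t => Γ ⁻¹' U t) (fun t => (hUo t).preimage Γ.continuous)
    (fun t _ => Set.mem_iUnion.2 ⟨t, hUp t⟩)
  -- Induction along a subdivision whose pieces each lie in one extension neighbourhood.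
  -- Compatibility is asked only for `s ≤ τ n`, since beyond it the family is not yet built.
  have key : ∀ n, ∃ F : unitInterval → ℂ → ℂ,
      (∀ t ≤ τ n, IsLocalSolution P Q (Γ t) (F t)) ∧ F 0 =ᶠ[𝓝 p] f ∧
      ∀ t ≤ τ n, ∀ᶠ s in 𝓝 t, s ≤ τ n → F s =ᶠ[𝓝 (Γ s)] F t := by
    intro n
    induction n with
    | zero =>
      have h0 : ∀ t ≤ τ 0, t = 0 := fun t ht => le_antisymm (hτ0 ▸ ht) t.2.1
      refine ⟨fun _ => f, fun t ht => ?_, EventuallyEq.rfl, fun t ht =>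
        Eventually.of_forall fun s hs => EventuallyEq.rfl⟩
      rw [h0 t ht, Γ.source]
      exact hf
    | succ n ih =>
      obtain ⟨F, hF, hF0, hFl⟩ := ih
      obtain ⟨i, hi⟩ := hτ n
      have hnn : τ n ≤ τ (n + 1) := hτm n.le_succ
      obtain ⟨h, hh, hhF⟩ := hU i (Γ (τ n)) (hi ⟨le_rfl, hnn⟩) _ (hF _ le_rfl)
      refine ⟨fun t => if t ≤ τ n then F t else h, fun t ht => ?_, ?_, fun t ht => ?_⟩
      · beta_reduce
        split_ifs with htn
        · exact hF t htn
        · exact hh _ (hi ⟨(not_le.1 htn).le, ht⟩)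
      · beta_reduce
        rw [if_pos (unitInterval.nonneg')]
        exact hF0
      · beta_reduce
        rcases lt_trichotomy t (τ n) with htn | htn | htn
        · filter_upwards [hFl t htn.le, gt_mem_nhds htn] with s hs hsn _
          rw [if_pos hsn.le, if_pos htn.le]
          exact hs hsn.le
        · have hhF' : h =ᶠ[𝓝 (Γ t)] F t := by rw [htn]; exact hhF
          filter_upwards [hFl t htn.le,
            eventuallyEq_nhds_of_eventuallyEq Γ.continuous.continuousAt hhF'] with s hs hs' _
          rw [if_pos htn.le]
          split_ifs with hsn
          · exact hs hsn
          · exact hs'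
        · filter_upwards [lt_mem_nhds htn] with s hs _
          rw [if_neg (not_le.2 hs), if_neg (not_le.2 htn)]
  obtain ⟨F, hF, hF0, hFl⟩ := key N
  rw [hN N le_rfl] at hF hFl
  refine ⟨F 1, ⟨F, fun t => (hF t unitInterval.le_one').1, fun t => ?_, hF0, EventuallyEq.rfl⟩, ?_⟩
  · filter_upwards [hFl t unitInterval.le_one'] with s hs using hs unitInterval.le_one'
  · simpa using hF 1 le_rfl

variable {P Q : ℂ → ℂ} {S : Set ℂ} {p q : ℂ} {y : Fin 2 → ℂ → ℂ}

/-- Transport of a fundamental system along a path conjugates the monodromy. -/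
theorem IsFundamentalSystem.exists_transport
    (hPQ : ∀ z ∉ S, AnalyticAt ℂ P z ∧ AnalyticAt ℂ Q z) (σ : Path p q) (hσ : ∀ t, σ t ∉ S)
    (hy : IsFundamentalSystem P Q p y) :
    ∃ y' : Fin 2 → ℂ → ℂ, IsFundamentalSystem P Q q y' ∧
      ∀ (Γ : Path q q) (N : GL (Fin 2) ℂ), IsMonodromyMatrix Γ y' N →
        IsMonodromyMatrix ((σ.trans Γ).trans σ.symm) y N := by
  choose y' hc hs using fun i => (hy.1 i).exists_continuation hPQ σ hσ
  refine ⟨y', ⟨hs, fun c h => hy.2 c ?_⟩, fun Γ N hN i => ?_⟩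
  · exact ((hc 0).symm.linearCombination (c 0) (c 1) (hc 1).symm).eventuallyEq
      (IsContinuationAlong.of_analyticAt (f := fun _ => (0 : ℂ)) fun _ => analyticAt_const) h
  · exact ((hc i).trans (hN i)).trans
      ((hc 0).symm.linearCombination (N i 0) (N i 1) (hc 1).symm)

theorem IsFundamentalSystem.exists_monodromyMatrix
    (hPQ : ∀ z ∉ S, AnalyticAt ℂ P z ∧ AnalyticAt ℂ Q z) (Γ : Path p p) (hΓ : ∀ t, Γ t ∉ S)
    (hy : IsFundamentalSystem P Q p y) : ∃ M : GL (Fin 2) ℂ, IsMonodromyMatrix Γ y M := by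
  have hp : p ∉ S := by simpa using hΓ 0
  have hW := hy.wronskian_ne_zero (hPQ p hp).1 (hPQ p hp).2
  choose g hc hs using fun i => (hy.1 i).exists_continuation hPQ Γ hΓ
  choose a b hab using fun i => (hy.1 0).exists_eq_combination (hy.1 1) hW (hs i)
  let N : Matrix (Fin 2) (Fin 2) ℂ := Matrix.of fun i => ![a i, b i]
  -- A relation between the continued germs, continued back along the reversed loop, would be a
  -- relation between the original ones.
  have hN : N.det ≠ 0 := by
    intro h0
    obtain ⟨v, hv, hv0⟩ := Matrix.exists_vecMul_eq_zero_iff.2 h0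
    have e0 : v 0 * a 0 + v 1 * a 1 = 0 := by
      simpa [Matrix.vecMul, dotProduct, Fin.sum_univ_two, N] using congrFun hv0 0
    have e1 : v 0 * b 0 + v 1 * b 1 = 0 := by
      simpa [Matrix.vecMul, dotProduct, Fin.sum_univ_two, N] using congrFun hv0 1
    refine hv (hy.2 v ?_)
    refine ((hc 0).symm.linearCombination (v 0) (v 1) (hc 1).symm).eventuallyEq
      (IsContinuationAlong.of_analyticAt (f := fun _ => (0 : ℂ)) fun _ => analyticAt_const) ?_
    filter_upwards [hab 0, hab 1] with z h0 h1
    rw [h0, h1]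
    linear_combination y 0 z * e0 + y 1 z * e1
  refine ⟨Matrix.GeneralLinearGroup.mkOfDetNeZero N hN, fun i => ?_⟩
  exact (hc i).congr EventuallyEq.rfl (hab i)

/-- Liouville's formula for the determinant of a monodromy matrix. -/
theorem IsMonodromyMatrix.det_mul_eq_one (hP : AnalyticAt ℂ P p) (hQ : AnalyticAt ℂ Q p)
    (hy : IsFundamentalSystem P Q p y) {Γ : Path p p} {M : GL (Fin 2) ℂ}
    (hM : IsMonodromyMatrix Γ y M) {f g : ℂ → ℂ} {μ : ℂ} (hfg : IsContinuationAlong Γ f g)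
    (hg : g p = μ * f p) (hf0 : f p ≠ 0) (hf : ∀ᶠ z in 𝓝 p, HasDerivAt f (P z * f z) z) :
    (M : Matrix (Fin 2) (Fin 2) ℂ).det * μ = 1 := by
  have hW := hy.wronskian_ne_zero hP hQ
  -- As `f' = P f` and `W' = -P W`, the product `W f` is constant, hence invariant under
  -- continuation, while its factors acquire `det M` and `μ`.
  have hconst : ∀ᶠ z in 𝓝 p, wronskian (y 0) (y 1) z * f z = wronskian (y 0) (y 1) p * f p := by
    refine eventually_eq_of_hasDerivAt_zero (φ := fun z => wronskian (y 0) (y 1) z * f z) ?_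
    filter_upwards [(hy.1 0).hasDerivAt_wronskian (hy.1 1), hf] with z h1 h2
    convert! h1.mul h2 using 1
    ring
  have h := (((hM 0).wronskian (hM 1)).mul hfg).eventuallyEq
    (IsContinuationAlong.of_analyticAt (f := fun _ => wronskian (y 0) (y 1) p * f p)
      fun _ => analyticAt_const) hconst
  have hd : ∀ a b : ℂ, deriv (fun z => a * y 0 z + b * y 1 z) p =
      a * deriv (y 0) p + b * deriv (y 1) p :=
    fun a b => (((hy.1 0).1.differentiableAt.hasDerivAt.const_mul a).add
      ((hy.1 1).1.differentiableAt.hasDerivAt.const_mul b)).deriv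
  have h := h.eq_of_nhds
  beta_reduce at h
  rw [hd, hd, hg] at h
  apply mul_right_cancel₀ (mul_ne_zero hW hf0)
  rw [one_mul]
  refine Eq.trans ?_ h
  rw [Matrix.det_fin_two, wronskian]
  ring

/-! ### Matrices preserving a sesquilinear form -/

theorem norm_det_eq_one {H N : Matrix (Fin 2) (Fin 2) ℂ} (hH : H.det ≠ 0)
    (h : N.conjTranspose * H * N = H) : ‖N.det‖ = 1 := by
  have h1 := congrArg Matrix.det h
  rw [Matrix.det_mul, Matrix.det_mul, Matrix.det_conjTranspose] at h1
  have h2 : star N.det * N.det = 1 := by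
    apply mul_right_cancel₀ hH
    linear_combination h1
  have h3 := congrArg norm h2
  rw [norm_mul, norm_star, norm_one] at h3
  nlinarith [norm_nonneg N.det]

/-- The spectrum of a matrix preserving a non-degenerate sesquilinear form is symmetric with respect
to the unit circle. -/
theorem eigenvalue_of_unitary {H N : Matrix (Fin 2) (Fin 2) ℂ} (hH : H.det ≠ 0)
    (h : N.conjTranspose * H * N = H) {lam : ℂ} (hN : (N - Matrix.scalar (Fin 2) lam).det = 0) :
    ‖lam‖ = 1 ∨ lam = N.det * star lam := by
  have h1 : (N - Matrix.scalar (Fin 2) lam).conjTranspose * H * N =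
      H * (1 - star lam • N) := by
    rw [Matrix.conjTranspose_sub, Matrix.sub_mul, Matrix.sub_mul, h, Matrix.mul_sub, Matrix.mul_one,
      Matrix.mul_smul]
    congr 1
    ext i j
    fin_cases i <;> fin_cases j <;>
      simp [Matrix.mul_apply, Fin.sum_univ_two, Matrix.diagonal] <;> ring
  have h2 := congrArg Matrix.det h1
  rw [Matrix.det_mul, Matrix.det_mul, Matrix.det_mul, Matrix.det_conjTranspose, hN, star_zero,
    zero_mul, zero_mul] at h2
  have h3 := (mul_eq_zero.1 h2.symm).resolve_left hH
  simp only [Matrix.det_fin_two, Matrix.sub_apply, Matrix.smul_apply, Matrix.one_apply,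
    Matrix.scalar_apply, Matrix.diagonal_apply, smul_eq_mul, Fin.isValue, if_true,
    Fin.zero_eq_one_iff, Fin.one_eq_zero_iff, OfNat.ofNat_ne_one, if_false, sub_zero, zero_sub]
    at h3 hN ⊢
  set μ := star lam with hμ
  -- The trace is eliminated between `det (N - λ) = 0` and `det (1 - conj λ · N) = 0`.
  have h4 : (lam - (N 0 0 * N 1 1 - N 0 1 * N 1 0) * μ) * (1 - lam * μ) = 0 := by
    linear_combination lam * h3 - μ * hN
  rcases mul_eq_zero.1 h4 with h5 | h5
  · right; exact sub_eq_zero.1 h5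
  · left
    have h6 := congrArg norm (sub_eq_zero.1 h5)
    rw [norm_mul, hμ, norm_star, norm_one] at h6
    nlinarith [norm_nonneg lam]

/-! ### Circles and their logarithms -/

/-- The circle with centre `c` through `c + ρ`, as a loop. -/
noncomputable def circleLoop (c ρ : ℂ) : Path (c + ρ) (c + ρ) where
  toFun t := c + ρ * Complex.exp (2 * Real.pi * Complex.I * (t : ℝ))
  continuous_toFun := by fun_prop
  source' := by simp
  target' := by simp [Complex.exp_two_pi_mul_I]

theorem circleLoop_apply (c ρ : ℂ) (t : unitInterval) :
    circleLoop c ρ t = c + ρ * Complex.exp (2 * Real.pi * Complex.I * (t : ℝ)) := rfl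

theorem norm_circleLoop_sub (c ρ : ℂ) (t : unitInterval) : ‖circleLoop c ρ t - c‖ = ‖ρ‖ := by
  rw [circleLoop_apply, add_sub_cancel_left, norm_mul, Complex.norm_exp]
  simp

/-- On the circle `z - s = (z - c)(1 - (s - c)/(z - c))`, and the second factor stays in the unit
disc around `1`, so only `z - c` winds. For `s` outside, the constant `c - s` is factored out
instead and nothing winds. -/
theorem exists_log_circleLoop_inside {c ρ s : ℂ} (h : ‖s - c‖ < ‖ρ‖) :
    ∃ L : unitInterval → ℂ, Continuous L ∧ (∀ t, Complex.exp (L t) = circleLoop c ρ t - s) ∧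
      L 1 - L 0 = 2 * Real.pi * Complex.I := by
  have hρ : ρ ≠ 0 := norm_pos_iff.1 ((norm_nonneg _).trans_lt h)
  let e : unitInterval → ℂ := fun t => Complex.exp (2 * Real.pi * Complex.I * (t : ℝ))
  have he : Continuous e := by fun_prop
  have he0 : ∀ t, e t ≠ 0 := fun t => Complex.exp_ne_zero _
  have hslit : ∀ t, 1 + -((s - c) / (ρ * e t)) ∈ Complex.slitPlane := fun t => by
    apply Complex.mem_slitPlane_of_norm_lt_one
    have : ‖e t‖ = 1 := by simp only [e]; rw [Complex.norm_exp]; simp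
    rw [norm_neg, norm_div, norm_mul, this, mul_one]
    exact (div_lt_one (norm_pos_iff.2 hρ)).2 h
  refine ⟨fun t => Complex.log ρ + 2 * Real.pi * Complex.I * (t : ℝ) +
    Complex.log (1 + -((s - c) / (ρ * e t))), ?_, fun t => ?_, ?_⟩
  · refine Continuous.add (by fun_prop) (Continuous.clog ?_ hslit)
    exact continuous_const.add (continuous_const.div (continuous_const.mul he)
      fun t => mul_ne_zero hρ (he0 t)).neg
  · rw [Complex.exp_add, Complex.exp_add, Complex.exp_log hρ,
      Complex.exp_log (Complex.slitPlane_ne_zero (hslit t)), circleLoop_apply]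
    change ρ * e t * _ = c + ρ * e t - s
    have := he0 t
    field_simp
    ring
  · have e1 : e 1 = e 0 := by simp [e, Complex.exp_two_pi_mul_I]
    simp [e1]

theorem exists_log_circleLoop_outside {c ρ s : ℂ} (h : ‖ρ‖ < ‖s - c‖) :
    ∃ L : unitInterval → ℂ, Continuous L ∧ (∀ t, Complex.exp (L t) = circleLoop c ρ t - s) ∧
      L 1 - L 0 = 0 := by
  have hsc : c - s ≠ 0 := by
    rw [← neg_sub, neg_ne_zero]
    exact norm_pos_iff.1 ((norm_nonneg _).trans_lt h)
  let e : unitInterval → ℂ := fun t => Complex.exp (2 * Real.pi * Complex.I * (t : ℝ))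
  have he : Continuous e := by fun_prop
  have hslit : ∀ t, 1 + ρ * e t / (c - s) ∈ Complex.slitPlane := fun t => by
    apply Complex.mem_slitPlane_of_norm_lt_one
    have : ‖e t‖ = 1 := by simp only [e]; rw [Complex.norm_exp]; simp
    rw [norm_div, norm_mul, this, mul_one, norm_sub_rev c s]
    exact (div_lt_one ((norm_nonneg _).trans_lt h)).2 h
  refine ⟨fun t => Complex.log (c - s) + Complex.log (1 + ρ * e t / (c - s)), ?_, fun t => ?_, ?_⟩
  · exact continuous_const.add (Continuous.clog (by fun_prop) hslit)
  · rw [Complex.exp_add, Complex.exp_log hsc,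
      Complex.exp_log (Complex.slitPlane_ne_zero (hslit t)), circleLoop_apply]
    change _ = c + ρ * e t - s
    field_simp
    ring
  · have e1 : e 1 = e 0 := by simp [e, Complex.exp_two_pi_mul_I]
    simp [e1]

open Classical in
/-- A branch of `(z - s) ^ e` on a circle and its multiplier. -/
theorem exists_powerBranch_circleLoop {c ρ s : ℂ} (e : ℂ) (h : ‖s - c‖ ≠ ‖ρ‖) :
    ∃ f g : ℂ → ℂ, IsContinuationAlong (circleLoop c ρ) f g ∧ f (c + ρ) ≠ 0 ∧
      (∀ᶠ z in 𝓝 (c + ρ), HasDerivAt f (e / (z - s) * f z) z) ∧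
      g =ᶠ[𝓝 (c + ρ)] fun z =>
        Complex.exp ((if ‖s - c‖ < ‖ρ‖ then e else 0) * (2 * Real.pi * Complex.I)) * f z := by
  rcases h.lt_or_gt with h | h
  · obtain ⟨L, hL, hexp, hd⟩ := exists_log_circleLoop_inside h
    obtain ⟨f, g, h1, h2, h3, h4⟩ := exists_powerBranch _ e hL hexp
    refine ⟨f, g, h1, h2, h3, ?_⟩
    rw [if_pos h, ← hd]
    exact h4 rfl
  · obtain ⟨L, hL, hexp, hd⟩ := exists_log_circleLoop_outside h
    obtain ⟨f, g, h1, h2, h3, h4⟩ := exists_powerBranch _ e hL hexp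
    refine ⟨f, g, h1, h2, h3, ?_⟩
    rw [if_neg h.le.not_gt, zero_mul]
    simpa [hd] using h4 rfl

/-! ### Monodromy of the Heun equation along circles -/

theorem analyticAt_coeff {a α β γ δ ε B z : ℂ} (hz : z ∉ ({0, 1, a} : Set ℂ)) :
    AnalyticAt ℂ (coeffP a γ δ ε) z ∧ AnalyticAt ℂ (coeffQ a α β B) z := by
  simp only [Set.mem_insert_iff, Set.mem_singleton_iff, not_or] at hz
  obtain ⟨h0, h1, ha⟩ := hz
  have h1' := sub_ne_zero.2 h1
  have ha' := sub_ne_zero.2 ha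
  have d1 : AnalyticAt ℂ (fun z : ℂ => z - 1) z := analyticAt_id.sub analyticAt_const
  have da : AnalyticAt ℂ (fun z : ℂ => z - a) z := analyticAt_id.sub analyticAt_const
  constructor
  · exact ((analyticAt_const.div analyticAt_id h0).add (analyticAt_const.div d1 h1')).add
      (analyticAt_const.div da ha')
  · exact ((analyticAt_const.mul analyticAt_id).sub analyticAt_const).div
      ((analyticAt_id.mul d1).mul da) (mul_ne_zero (mul_ne_zero h0 h1') ha')

open Classical in
/-- The sum of those of the exponents `γ, δ, ε` whose singular point lies inside a circle. -/
noncomputable def exponentInside (a γ δ ε c ρ : ℂ) : ℂ :=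
  (if ‖0 - c‖ < ‖ρ‖ then γ else 0) + (if ‖1 - c‖ < ‖ρ‖ then δ else 0) +
    (if ‖a - c‖ < ‖ρ‖ then ε else 0)

theorem circleLoop_notMem {a c ρ : ℂ} (h0 : ‖0 - c‖ ≠ ‖ρ‖) (h1 : ‖1 - c‖ ≠ ‖ρ‖)
    (ha : ‖a - c‖ ≠ ‖ρ‖) (t : unitInterval) : circleLoop c ρ t ∉ ({0, 1, a} : Set ℂ) := by
  have h := norm_circleLoop_sub c ρ t
  intro hm
  simp only [Set.mem_insert_iff, Set.mem_singleton_iff] at hm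
  rcases hm with hm | hm | hm <;> rw [hm] at h
  exacts [h0 h, h1 h, ha h]

/-- Conjugating by a path from `p` in the path-connected complement puts `N` in the group based at
`p`. The determinant comes from the multiplier of `z^γ (z - 1)^δ (z - a)^ε`, a solution of `f' = P
f`. -/
theorem exists_circle_monodromy {a α β γ δ ε B p c ρ : ℂ} (hp : p ∉ ({0, 1, a} : Set ℂ))
    {y : Fin 2 → ℂ → ℂ} (hy : IsFundamentalSystem (coeffP a γ δ ε) (coeffQ a α β B) p y)
    (h0 : ‖0 - c‖ ≠ ‖ρ‖) (h1 : ‖1 - c‖ ≠ ‖ρ‖) (ha : ‖a - c‖ ≠ ‖ρ‖) :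
    ∃ (y' : Fin 2 → ℂ → ℂ) (N : GL (Fin 2) ℂ),
      IsFundamentalSystem (coeffP a γ δ ε) (coeffQ a α β B) (c + ρ) y' ∧
      IsMonodromyMatrix (circleLoop c ρ) y' N ∧ N ∈ monodromyGroup {0, 1, a} p y ∧
      (N : Matrix (Fin 2) (Fin 2) ℂ).det *
        Complex.exp (exponentInside a γ δ ε c ρ * (2 * Real.pi * Complex.I)) = 1 := by
  have hC := circleLoop_notMem h0 h1 ha
  have hq : c + ρ ∉ ({0, 1, a} : Set ℂ) := by simpa using hC 0
  have hPQ : ∀ z ∉ ({0, 1, a} : Set ℂ), AnalyticAt ℂ (coeffP a γ δ ε) z ∧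
      AnalyticAt ℂ (coeffQ a α β B) z := fun z hz => analyticAt_coeff hz
  have hconn : IsPathConnected ({0, 1, a} : Set ℂ)ᶜ :=
    (Set.toFinite _).countable.isPathConnected_compl_of_one_lt_rank (by simp)
  obtain ⟨σ, hσ⟩ := hconn.joinedIn p hp (c + ρ) hq
  obtain ⟨y', hy', htr⟩ := hy.exists_transport hPQ σ hσ
  obtain ⟨N, hN⟩ := hy'.exists_monodromyMatrix hPQ _ hC
  refine ⟨y', N, hy', hN, Subgroup.subset_closure ⟨_, fun t => ?_, htr _ N hN⟩, ?_⟩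
  · have hr : Set.range ((σ.trans (circleLoop c ρ)).trans σ.symm) ⊆ ({0, 1, a} : Set ℂ)ᶜ := by
      rw [Path.trans_range, Path.trans_range, Path.symm_range]
      refine Set.union_subset (Set.union_subset ?_ ?_) ?_ <;> rintro _ ⟨u, rfl⟩
      exacts [hσ u, hC u, hσ u]
    exact hr ⟨t, rfl⟩
  · obtain ⟨f, f', f1, f2, f3, f4⟩ := exists_powerBranch_circleLoop γ h0
    obtain ⟨g, g', g1, g2, g3, g4⟩ := exists_powerBranch_circleLoop δ h1
    obtain ⟨k, k', k1, k2, k3, k4⟩ := exists_powerBranch_circleLoop ε ha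
    refine hN.det_mul_eq_one (hPQ _ hq).1 (hPQ _ hq).2 hy' ((f1.mul g1).mul k1) ?_
      (mul_ne_zero (mul_ne_zero f2 g2) k2) ?_
    · rw [f4.eq_of_nhds, g4.eq_of_nhds, k4.eq_of_nhds, exponentInside, add_mul, add_mul,
        Complex.exp_add, Complex.exp_add]
      ring
    · filter_upwards [f3, g3, k3] with z hf hg hk
      convert! (hf.mul hg).mul hk using 1
      simp only [coeffP, sub_zero, Pi.mul_apply]
      ring

theorem im_eq_zero_of_norm_exp {w : ℂ} (h : ‖Complex.exp (w * (2 * Real.pi * Complex.I))‖ = 1) :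
    w.im = 0 := by
  rw [Complex.norm_exp, Real.exp_eq_one_iff] at h
  have h2 : w.im * (2 * Real.pi) = 0 := by
    simpa using h
  exact (mul_eq_zero.1 h2).resolve_right (by positivity)

theorem exponentInside_im_eq_zero {a α β γ δ ε B p c ρ : ℂ} (hp : p ∉ ({0, 1, a} : Set ℂ))
    {y : Fin 2 → ℂ → ℂ} (hy : IsFundamentalSystem (coeffP a γ δ ε) (coeffQ a α β B) p y)
    (hG : IsUnitary (monodromyGroup {0, 1, a} p y))
    (h0 : ‖0 - c‖ ≠ ‖ρ‖) (h1 : ‖1 - c‖ ≠ ‖ρ‖) (ha : ‖a - c‖ ≠ ‖ρ‖) :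
    (exponentInside a γ δ ε c ρ).im = 0 := by
  obtain ⟨H, -, hH, hU⟩ := hG
  obtain ⟨y', N, -, -, hN, hdet⟩ := exists_circle_monodromy hp hy h0 h1 ha
  have h := congrArg norm hdet
  rw [norm_mul, norm_det_eq_one hH (hU N hN), one_mul, norm_one] at h
  exact im_eq_zero_of_norm_exp h

/-! ### The exponents at infinity -/

/-- The Frobenius solution at infinity with the exponent `α` of larger real part, and its
multiplier along large circles. -/
theorem exists_frobenius_at_infinity {a α β γ δ ε B : ℂ} (hsum : γ + δ + ε = 1 + α + β)
    (hre : β.re ≤ α.re) :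
    ∃ R₀ : ℝ, ∀ q : ℂ, R₀ < ‖q‖ → ∃ f g : ℂ → ℂ, IsContinuationAlong (circleLoop 0 q) f g ∧
      IsLocalSolution (coeffP a γ δ ε) (coeffQ a α β B) (0 + q) f ∧ f (0 + q) ≠ 0 ∧
      g =ᶠ[𝓝 (0 + q)] fun z => Complex.exp (-α * (2 * Real.pi * Complex.I)) * f z := by
  let κ : ℂ → ℂ := fun t => (α * β - B / 4 * t) / ((1 - t) * (1 - a * t))
  let π : ℂ → ℂ := fun t => γ + δ / (1 - t) + ε / (1 - a * t)
  -- With `t = 1/z` and `y = t^α u`, put `w = t u' + α u`; then `κ = z² Q`, `π = z P`, and the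
  -- equation becomes a Fuchsian system for `(u, w)`.
  let A : ℂ → Matrix (Fin 2) (Fin 2) ℂ := fun t => !![-α, 1; -κ t, π t - 1 - α]
  have d1 : AnalyticAt ℂ (fun t : ℂ => 1 - t) 0 := analyticAt_const.sub analyticAt_id
  have da : AnalyticAt ℂ (fun t : ℂ => 1 - a * t) 0 :=
    analyticAt_const.sub (analyticAt_const.mul analyticAt_id)
  have hκ : AnalyticAt ℂ κ 0 := (analyticAt_const.sub (analyticAt_const.mul analyticAt_id)).div
    (d1.mul da) (by simp)
  have hπ : AnalyticAt ℂ π 0 := (analyticAt_const.add (analyticAt_const.div d1 (by simp))).add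
    (analyticAt_const.div da (by simp))
  have hA : ∀ i j, AnalyticAt ℂ (fun t => A t i j) 0 := by
    intro i j
    fin_cases i <;> fin_cases j
    exacts [analyticAt_const, analyticAt_const, hκ.neg,
      (hπ.sub analyticAt_const).sub analyticAt_const]
  have hA0 : A 0 = !![-α, 1; -(α * β), β] := by
    have e1 : κ 0 = α * β := by simp [κ]
    have e2 : π 0 - 1 - α = β := by
      simp only [π, sub_zero, mul_zero, div_one]
      linear_combination hsum
    simp only [A, e1, e2]
  -- `A 0` has eigenvalues `0` and `β - α`, the latter never a positive integer as `Re β ≤ Re α`.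
  -- The kernel vector `(1, α)` fills the first column of `v`; the zero second column is padding.
  obtain ⟨y, hy, hy0, hyd⟩ := exists_fuchsian_matrix_solution hA (v := !![1, 0; α, 0]) (fun n => by
      rw [Matrix.isUnit_iff_isUnit_det, isUnit_iff_ne_zero, hA0, Matrix.det_fin_two]
      simp only [Matrix.algebraMap_matrix_apply, Matrix.sub_apply]
      simp
      intro h
      have h2 : ((n : ℂ) + 1) * ((n : ℂ) + 1 + (α - β)) = 0 := by linear_combination h
      rcases mul_eq_zero.1 h2 with h3 | h3
      · exact Nat.cast_add_one_ne_zero n h3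
      · have h4 := congrArg Complex.re h3
        simp at h4
        have : (0 : ℝ) ≤ n := n.cast_nonneg
        linarith) (by
      rw [hA0]
      ext i j
      fin_cases i <;> fin_cases j <;> (simp [Matrix.mul_apply, Fin.sum_univ_two]; try ring))
  set u := y 0 0
  set w := y 1 0
  have hu : ∀ᶠ t in 𝓝 0, AnalyticAt ℂ u t ∧ AnalyticAt ℂ w t ∧ t * deriv u t = -α * u t + w t ∧
      t * deriv w t = -κ t * u t + (π t - 1 - α) * w t ∧ u t ≠ 0 ∧ 1 - t ≠ 0 ∧ 1 - a * t ≠ 0 := by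
    filter_upwards [(hy 0 0).eventually_analyticAt, (hy 1 0).eventually_analyticAt, hyd 0 0, hyd 1 0,
      (hy 0 0).continuousAt.eventually_ne (show y 0 0 0 ≠ 0 by simp [hy0]),
      d1.continuousAt.eventually_ne (by simp : (1 : ℂ) - 0 ≠ 0),
      da.continuousAt.eventually_ne (by simp : (1 : ℂ) - a * 0 ≠ 0)] with t h1 h2 h3 h4 h5 h6 h7
    exact ⟨h1, h2, by simpa [A] using h3, by simpa [A] using h4, h5, h6, h7⟩
  obtain ⟨τ, hτ, hb⟩ := Metric.eventually_nhds_iff_ball.1 hu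
  have hout : ∀ z : ℂ, τ⁻¹ < ‖z‖ → z⁻¹ ∈ Metric.ball (0 : ℂ) τ := fun z hz => by
    rw [mem_ball_zero_iff, norm_inv]
    exact inv_lt_of_inv_lt₀ hτ hz
  have hτ' : 0 < τ⁻¹ := inv_pos.2 hτ
  refine ⟨τ⁻¹, fun q hq => ?_⟩
  have hq0 : (0 : ℝ) < ‖q‖ := hτ'.trans hq
  have hne : ∀ z : ℂ, τ⁻¹ < ‖z‖ → z ≠ 0 := fun z hz => norm_pos_iff.1 (hτ'.trans hz)
  obtain ⟨h, h', c1, c2, c3, c4⟩ := exists_powerBranch_circleLoop (c := 0) (ρ := q) (s := 0) (-α)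
    (by simpa using hq0.ne)
  have hua : ∀ z : ℂ, τ⁻¹ < ‖z‖ → AnalyticAt ℂ (fun z => u z⁻¹) z := fun z hz =>
    AnalyticAt.fun_comp (hb _ (hout z hz)).1 (analyticAt_inv (hne z hz))
  have hcont : IsContinuationAlong (circleLoop 0 q) (fun z => u z⁻¹) (fun z => u z⁻¹) := by
    refine .of_analyticAt fun t => hua _ ?_
    have := norm_circleLoop_sub 0 q t
    rw [sub_zero] at this
    rwa [this]
  have hnear : ∀ᶠ z in 𝓝 (0 + q), τ⁻¹ < ‖z‖ := by
    refine (continuous_norm.tendsto (0 + q)).eventually (lt_mem_nhds ?_)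
    rwa [zero_add]
  have hinv : ∀ {φ : ℂ → ℂ} {z : ℂ}, z ≠ 0 → AnalyticAt ℂ φ z⁻¹ →
      HasDerivAt (fun z => φ z⁻¹) (deriv φ z⁻¹ * -(z ^ 2)⁻¹) z := fun hz hφ =>
    hφ.differentiableAt.hasDerivAt.comp _ (hasDerivAt_inv hz)
  have hd1 : ∀ᶠ z in 𝓝 (0 + q), HasDerivAt (fun z => h z * u z⁻¹) (-(h z / z * w z⁻¹)) z := by
    filter_upwards [hnear, c3] with z hz hh
    obtain ⟨h1, h2, h3, h4, h5, h6, h7⟩ := hb _ (hout z hz)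
    have hz0 := hne z hz
    convert! hh.mul (hinv hz0 h1) using 1
    have h3' : deriv u z⁻¹ = z * (-α * u z⁻¹ + w z⁻¹) := by
      rw [← h3, mul_inv_cancel_left₀ hz0]
    rw [h3', sub_zero]
    field_simp
    ring
  refine ⟨fun z => h z * u z⁻¹, fun z => h' z * u z⁻¹, c1.mul hcont, ⟨?_, ?_⟩, ?_, ?_⟩
  · exact c1.symm.analyticAt_right.mul (hua _ (by rwa [zero_add]))
  · have e1 : deriv (fun z => h z * u z⁻¹) =ᶠ[𝓝 (0 + q)] fun z => -(h z / z * w z⁻¹) := by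
      filter_upwards [hd1] with z hz using hz.deriv
    filter_upwards [e1, e1.deriv, hnear, c3] with z e1 e2 hz hh
    obtain ⟨h1, h2, h3, h4, h5, h6, h7⟩ := hb _ (hout z hz)
    have hz0 := hne z hz
    have hz1 : z - 1 ≠ 0 := fun h0 => h6 (by rw [sub_eq_zero.1 h0]; simp)
    have hza : z - a ≠ 0 := fun h0 => h7 (by
      rw [← sub_eq_zero.1 h0, mul_inv_cancel₀ hz0, sub_self])
    have h4' : deriv w z⁻¹ = z * (-κ z⁻¹ * u z⁻¹ + (π z⁻¹ - 1 - α) * w z⁻¹) := by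
      rw [← h4, mul_inv_cancel_left₀ hz0]
    have hκz : κ z⁻¹ = z ^ 2 * coeffQ a α β B z := by
      simp only [κ, coeffQ]
      have e3 : 1 - z⁻¹ = (z - 1) / z := by field_simp
      have e4 : 1 - a * z⁻¹ = (z - a) / z := by field_simp
      rw [e3, e4]
      field_simp
    have hπz : π z⁻¹ = z * coeffP a γ δ ε z := by
      simp only [π, coeffP]
      have e3 : 1 - z⁻¹ = (z - 1) / z := by field_simp
      have e4 : 1 - a * z⁻¹ = (z - a) / z := by field_simp
      rw [e3, e4]
      field_simp
    have hd2 := ((hh.div (hasDerivAt_id z) hz0).mul (hinv hz0 h2)).neg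
    have e5 : deriv (fun z => -(h z / z * w z⁻¹)) z = _ := hd2.deriv
    rw [e2, e1, e5, h4', hκz, hπz]
    simp only [id, sub_zero, Pi.div_apply]
    field_simp
    ring
  · exact mul_ne_zero c2 (hb _ (hout _ (by rwa [zero_add]))).2.2.2.2.1
  · filter_upwards [c4] with z hz
    rw [hz, if_pos (by simpa using hq0), mul_assoc]

theorem im_eq_zero_or_sub_conj_int {a α β γ δ ε B p : ℂ}
    (hsum : γ + δ + ε = 1 + α + β) (hp : p ∉ ({0, 1, a} : Set ℂ)) {y : Fin 2 → ℂ → ℂ}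
    (hy : IsFundamentalSystem (coeffP a γ δ ε) (coeffQ a α β B) p y)
    (hG : IsUnitary (monodromyGroup {0, 1, a} p y)) (hre : β.re ≤ α.re) :
    α.im = 0 ∨ ∃ n : ℤ, α - (starRingEnd ℂ) β = (n : ℂ) := by
  obtain ⟨R₀, hR⟩ := exists_frobenius_at_infinity (a := a) (B := B) hsum hre
  obtain ⟨R, hRm⟩ := exists_gt (max (max R₀ 1) ‖a‖)
  obtain ⟨hR1, hRa⟩ := max_lt_iff.1 hRm
  obtain ⟨hR0, hR1⟩ := max_lt_iff.1 hR1
  have hnR : ‖(R : ℂ)‖ = R := by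
    rw [Complex.norm_real, Real.norm_of_nonneg (by linarith)]
  obtain ⟨f, g, hfg, hf, hf0, hg⟩ := hR R (by rwa [hnR])
  have k0 : ‖(0 : ℂ) - 0‖ < ‖(R : ℂ)‖ := by rw [hnR]; simp; linarith
  have k1 : ‖(1 : ℂ) - 0‖ < ‖(R : ℂ)‖ := by rw [hnR]; simpa using hR1
  have ka : ‖a - 0‖ < ‖(R : ℂ)‖ := by rw [hnR]; simpa using hRa
  obtain ⟨y', N, hy', hN, hNG, hdet⟩ := exists_circle_monodromy hp hy k0.ne k1.ne ka.ne
  have hq : (0 : ℂ) + R ∉ ({0, 1, a} : Set ℂ) := by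
    simpa using circleLoop_notMem k0.ne k1.ne ka.ne 0
  obtain ⟨hPa, hQa⟩ := analyticAt_coeff (α := α) (β := β) (γ := γ) (δ := δ) (ε := ε) (B := B) hq
  obtain ⟨c, d, hcd⟩ := (hy'.1 0).exists_eq_combination (hy'.1 1)
    (hy'.wronskian_ne_zero hPa hQa) hf
  set lam := Complex.exp (-α * (2 * Real.pi * Complex.I)) with hlam
  have heig := ((hN 0).linearCombination c d (hN 1)).eventuallyEq hfg hcd.symm
  -- The coordinates of the Frobenius solution form a left eigenvector of `N` for `lam`.
  set v : Fin 2 → ℂ := ![c, d] with hv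
  have hv0 : v ≠ 0 := by
    intro h
    have hc : c = 0 := congrFun h 0
    have hd : d = 0 := congrFun h 1
    apply hf0
    rw [hcd.eq_of_nhds, hc, hd]
    simp
  have hvN := hy'.2 (fun j => c * N 0 j + d * N 1 j - lam * v j) (by
    filter_upwards [heig, hg, hcd] with z e1 e2 e3
    rw [e2, e3] at e1
    simp only [hv, Matrix.cons_val_zero, Matrix.cons_val_one]
    linear_combination e1)
  have hdetN : ((N : Matrix (Fin 2) (Fin 2) ℂ) - Matrix.scalar (Fin 2) lam).det = 0 := by
    refine Matrix.exists_vecMul_eq_zero_iff.1 ⟨v, hv0, ?_⟩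
    ext j
    have := congrFun hvN j
    rw [Matrix.vecMul_sub, Pi.sub_apply]
    fin_cases j <;>
      simpa [Matrix.vecMul, dotProduct, Fin.sum_univ_two, hv, mul_comm] using this
  obtain ⟨H, -, hH, hU⟩ := hG
  rcases eigenvalue_of_unitary hH (hU N hNG) hdetN with h | h
  · left
    simpa using im_eq_zero_of_norm_exp h
  · right
    rw [exponentInside, if_pos k0, if_pos k1, if_pos ka, hsum] at hdet
    have h2 : Complex.exp (2 * Real.pi * Complex.I) = 1 := Complex.exp_two_pi_mul_I
    have hstar : star lam = Complex.exp ((starRingEnd ℂ) α * (2 * Real.pi * Complex.I)) := by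
      change (starRingEnd ℂ) lam = _
      rw [hlam, ← Complex.exp_conj, map_mul, map_neg, map_mul, map_mul, Complex.conj_ofReal,
        Complex.conj_I, map_ofNat]
      congr 1
      ring
    -- Substituting `det N` into `λ = det N · conj λ` leaves `exp(2πiβ) = exp(2πi conj α)`.
    have h3 : Complex.exp ((β - (starRingEnd ℂ) α) * (2 * Real.pi * Complex.I)) = 1 := by
      have e1 : lam * Complex.exp ((1 + α + β) * (2 * Real.pi * Complex.I)) = star lam := by
        linear_combination
          Complex.exp ((1 + α + β) * (2 * Real.pi * Complex.I)) * h + star lam * hdet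
      rw [hstar, hlam, ← Complex.exp_add] at e1
      rw [sub_mul, Complex.exp_sub, ← e1, div_eq_one_iff_eq (Complex.exp_ne_zero _)]
      rw [show -α * (2 * Real.pi * Complex.I) + (1 + α + β) * (2 * Real.pi * Complex.I) =
        2 * Real.pi * Complex.I + β * (2 * Real.pi * Complex.I) by ring, Complex.exp_add, h2,
        one_mul]
    obtain ⟨n, hn⟩ := Complex.exp_eq_one_iff.1 h3
    have h4 := mul_right_cancel₀ Complex.two_pi_I_ne_zero hn
    refine ⟨-n, ?_⟩
    have h5 := congrArg (starRingEnd ℂ) h4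
    rw [map_sub, Complex.conj_conj, map_intCast] at h5
    push_cast
    rw [← h5]; ring

end Heun

/-! ### Assembly of the result -/

theorem proposition2 (a α β γ δ ε B : ℂ) (ha0 : a ≠ 0) (ha1 : a ≠ 1)
    (hsum : γ + δ + ε = 1 + α + β)
    (p : ℂ) (hp : p ∉ ({0, 1, a} : Set ℂ)) (y : Fin 2 → ℂ → ℂ)
    (hy : Heun.IsFundamentalSystem (Heun.coeffP a γ δ ε) (Heun.coeffQ a α β B) p y)
    (hG : Heun.IsUnitary (Heun.monodromyGroup {0, 1, a} p y)) :
    (γ.im = 0 ∧ δ.im = 0 ∧ ε.im = 0) ∧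
      ((α.im = 0 ∧ β.im = 0) ∨ ∃ n : ℤ, α - (starRingEnd ℂ) β = (n : ℂ)) := by
  have ha1' : 0 < ‖a - 1‖ := norm_pos_iff.2 (sub_ne_zero.2 ha1)
  have ha0' : 0 < ‖a‖ := norm_pos_iff.2 ha0
  -- A radius small enough that the circle around `c` encloses no singular point other than possibly
  -- `c`.
  have key : ∀ c : ℂ, ∃ ρ : ℂ, 0 < ‖ρ‖ ∧ ∀ s ∈ ({0, 1, a} : Set ℂ), s ≠ c → ‖ρ‖ < ‖s - c‖ := by
    intro c
    have hfin : (({0, 1, a} : Set ℂ) \ {c}).Finite := (Set.toFinite _).sdiff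
    have hev : ∀ᶠ z in 𝓝[≠] (0 : ℂ), 0 < ‖z‖ ∧ ∀ s ∈ ({0, 1, a} : Set ℂ) \ {c}, ‖z‖ < ‖s - c‖ := by
      refine Eventually.and ?_ ((hfin.eventually_all).2 fun s hs => ?_)
      · filter_upwards [self_mem_nhdsWithin] with z hz using norm_pos_iff.2 hz
      · refine Eventually.filter_mono nhdsWithin_le_nhds ?_
        refine (continuous_norm.tendsto (0 : ℂ)).eventually (gt_mem_nhds ?_)
        rw [norm_zero]
        exact norm_pos_iff.2 (sub_ne_zero.2 hs.2)
    obtain ⟨ρ, h1, h2⟩ := hev.exists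
    exact ⟨ρ, h1, fun s hs hsc => h2 s ⟨hs, hsc⟩⟩
  have hγ : γ.im = 0 := by
    obtain ⟨ρ, h, hs⟩ := key 0
    have k0 : ‖(0 : ℂ) - 0‖ < ‖ρ‖ := by simpa using h
    have k1 := hs 1 (by simp) one_ne_zero
    have ka := hs a (by simp) ha0
    have := Heun.exponentInside_im_eq_zero hp hy hG k0.ne k1.ne' ka.ne'
    rw [Heun.exponentInside, if_pos k0, if_neg k1.not_gt, if_neg ka.not_gt] at this
    simpa using this
  have hδ : δ.im = 0 := by
    obtain ⟨ρ, h, hs⟩ := key 1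
    have k0 := hs 0 (by simp) zero_ne_one
    have k1 : ‖(1 : ℂ) - 1‖ < ‖ρ‖ := by simpa using h
    have ka := hs a (by simp) ha1
    have := Heun.exponentInside_im_eq_zero hp hy hG k0.ne' k1.ne ka.ne'
    rw [Heun.exponentInside, if_neg k0.not_gt, if_pos k1, if_neg ka.not_gt] at this
    simpa using this
  have hε : ε.im = 0 := by
    obtain ⟨ρ, h, hs⟩ := key a
    have k0 := hs 0 (by simp) ha0.symm
    have k1 := hs 1 (by simp) ha1.symm
    have ka : ‖a - a‖ < ‖ρ‖ := by simpa using h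
    have := Heun.exponentInside_im_eq_zero hp hy hG k0.ne' k1.ne' ka.ne
    rw [Heun.exponentInside, if_neg k0.not_gt, if_neg k1.not_gt, if_pos ka] at this
    simpa using this
  refine ⟨⟨hγ, hδ, hε⟩, ?_⟩
  have him : α.im + β.im = 0 := by
    have := congrArg Complex.im hsum
    simp only [Complex.add_im, hγ, hδ, hε, Complex.one_im] at this
    linarith
  rcases le_total β.re α.re with hre | hre
  · refine (Heun.im_eq_zero_or_sub_conj_int hsum hp hy hG hre).imp_left fun h => ⟨h, ?_⟩
    linarith
  · have hQ : Heun.coeffQ a α β B = Heun.coeffQ a β α B := by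
      ext z
      rw [Heun.coeffQ, Heun.coeffQ, mul_comm α β]
    rw [hQ] at hy
    rcases Heun.im_eq_zero_or_sub_conj_int (by rw [hsum]; ring) hp hy hG hre with h | ⟨n, hn⟩
    · exact Or.inl ⟨by linarith, h⟩
    · refine Or.inr ⟨-n, ?_⟩
      have h5 := congrArg (starRingEnd ℂ) hn
      rw [map_sub, Complex.conj_conj, map_intCast] at h5
      push_cast
      rw [← h5]; ring
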